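/- **Setting.** For $u(x)=\sum_{k\in\mathbb Z}u_ke^{ikx}$ on $\mathbb T=\mathbb R/2\pi\mathbb Z$ let $\|u\|_s^2=\sum_k\langle k\rangle^{2s}|u_k|^2$, $\langle\xi\rangle=\max(1,|\xi|)$, $H^s=\{u:\|u\|_s<\infty\}$, $\|\cdot\|_{L^2}=\|\cdot\|_0$, $(\tau_\varsigma u)(x)=u(x+\varsigma)$. Put $z^\top=z_1e^{ix}+z_{-1}e^{-ix}=\Pi^\top z$, $z^\perp=z-z^\top=\Pi^\perp z$, $\Lambda=\{1,-1\}$, $u_j^+=z_j$, $u_j^-=\overline{z_j}$. Fix $\alpha\in(0,1)$, $r>0$, $\mathfrak s_0$, and the following objects. * *Cut-offs.* For some $0<\delta_0\le\frac1{10}$, smooth real functions $\chi(\xi',\xi)$, $\chi_2(\xi'_1,\xi'_2,\xi)$, even in each argument, supported in $|\xi'|\le\delta_0\langle\xi\rangle$, equal to $1$ for $|\xi'|\le\delta_0\langle\xi\rangle/2$ (with $|\xi'|=\max(|\xi_1'|,|\xi_2'|)$ for $\chi_2$), with $|\partial_\xi^\ell\partial_{\xi'}^\beta\chi|,|\partial_\xi^\ell\partial_{\xi'}^\beta\chi_2|\le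 C_{\ell,\beta}\langle\xi\rangle^{-\ell-|\beta|}$. For a 2-homogeneous symbol $a(z;x,\xi)=\sum a_{j_1,j_2}^{\sigma_1,\sigma_2}(\xi)u_{j_1}^{\sigma_1}u_{j_2}^{\sigma_2}e^{i(\sigma_1j_1+\sigma_2j_2)x}$ (sum over $j_1,j_2\in\mathbb Z$, $\sigma_1,\sigma_2=\pm$), $\mathrm{Op}(a)v$ has $k$-th Fourier coefficient $\sum_{\sigma_1j_1+\sigma_2j_2+j=k}\chi_2(j_1,j_2,\frac{j+k}2)\,a_{j_1,j_2}^{\sigma_1,\sigma_2}(\frac{j+k}2)\,u_{j_1}^{\sigma_1}u_{j_2}^{\sigma_2}v_j$. For any other symbol it has $k$-th coefficient $\sum_j\chi(k-j,\frac{j+k}2)\,\hat a(k-j,\frac{j+k}2)\,v_j$, where $\hat a(n,\xi)$ is the $n$-th Fourier coefficient of $x\mapsto a(x,\xi)$. * *A 2-homogeneous symbol $a_2$* with coefficients smooth in $\xi$, symmetric under exchange of $(j_1,\sigma_1)$ and $(j_2,\sigma_2)$, with $|\partial_\xi^\beta a_{j_1,j_2}^{\sigma_1,\sigma_2}(\xi)|\le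 C_\beta\max(|j_1|,|j_2|)^{\mu}\langle\xi\rangle^{\alpha-\beta}$ for all $\beta\ge0$, for some $\mu\ge0$ with $\mathfrak s_0\ge\mu+1$; for $z\in H^{\mathfrak s_0}$ it is real valued, satisfies $a_2(e^{i\vartheta}z)=a_2(z)$ for all $\vartheta\in\mathbb R$, and has zero average in $x$. Let $\langle V\rangle(z;x)=2\,\mathrm{Re}\sum_{n\ge1}z_n\overline{z_{-n}}e^{2inx}$; $\langle V\rangle\xi$ is treated as a 2-homogeneous symbol. * *Real valued non-homogeneous symbols* $V_{4}(z;x)$ (order $m=0$, independent of $\xi$) and $a_{4}(z;x,\xi)$ (order $m=\alpha$), defined for $\|z\|_{\mathfrak s_0}<r$, $2\pi$-periodic in $x$, $C^\infty$ in $\xi$, with $a(\tau_\varsigma z;x,\xi)=a(z;x+\varsigma,\xi)$, and such that for every $\mathtt s\ge\mathfrak s_0$ there are $r'\in(0,r)$ and $C_\beta$ with $\|\partial_\xi^\beta a(z;\cdot,\xi)\|_{W^{N,\infty}}\le C_\beta\langle\xi\rangle^{m-\beta}\|z\|_{\mathfrak s_0}^{3}\|z\|_{\mathtt s}$ whenever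 $z\in H^{\mathtt s}$, $\|z\|_{\mathfrak s_0}<r'$, $\beta\in\mathbb N_0$, $\xi\in\mathbb R$, $N\in\mathbb N_0$, $N\le\mathtt s-\mathfrak s_0$. Here $W^{N,\infty}$ consists of the continuous periodic functions with bounded weak derivatives up to order $N$, and its norm is the sum of the $L^\infty$ norms of these derivatives. * *A cubic smoothing field* $X(z)_k=\sum R_{j_1,j_2,j_3}^{\sigma_1,\sigma_2,\sigma_3}u_{j_1}^{\sigma_1}u_{j_2}^{\sigma_2}u_{j_3}^{\sigma_3}$, sum over $\sigma_1j_1+\sigma_2j_2+\sigma_3j_3=k$, $\sigma_1+\sigma_2+\sigma_3=1$, with $R$ symmetric in its first two index pairs and $|R|\le C\,m_2^{\mu'}m_1^{-4}$, where $m_1\ge m_2$ are the two largest of $\langle j_1\rangle,\langle j_2\rangle,\langle j_3\rangle$, $\mu'\ge0$, $\mathfrak s_0\ge\mu'+1$. Let $\Pi_nX$ be the part of the sum in which exactly $n$ of $j_1,j_2,j_3,k$ lie outside $\Lambda$. For all $z\in H^{\mathfrak s_0}$, $\Pi_1X=\Pi_2X=0$ and $\Pi_0X=Y^{(\Lambda)}$,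 where $Y^{(\Lambda)}(z)=-i|z_1|^2z_1e^{ix}+i|z_{-1}|^2z_{-1}e^{-ix}$. * *Operators* $B_1(z),B_2(z)$ for $\|z\|_{\mathfrak s_0}<r$, linear on $H^{\mathfrak s_0}$, with $B_i(\tau_\varsigma z)\tau_\varsigma v=\tau_\varsigma(B_i(z)v)$, such that for every $\mathtt s\ge\mathfrak s_0$ there are $C$ and $r'\in(0,r)$ with $\|B_i(z)v\|_{\mathtt s}\le C(\|v\|_{\mathtt s}\|z\|_{\mathfrak s_0}^4+\|v\|_{\mathfrak s_0}\|z\|_{\mathfrak s_0}^3\|z\|_{\mathtt s})$ for $z,v\in H^{\mathtt s}$, $\|z\|_{\mathfrak s_0}<r'$. Put $B(z)=B_1(z)z+B_2(z)\bar z$. With $m_{4}=V_4\xi+a_4$ and $m=\langle V\rangle\xi+a_2+m_{4}$, consider the system $$\begin{aligned}\partial_tz^\top&=-i|D|^\alpha z^\top+Y^{(\Lambda)}(z^\top)+\Pi^\top\big(X(z)-\Pi_0X(z)\big)+\Pi^\top B(z)+\Pi^\top\mathrm{Op}(im_{4})z^\top,\\ \partial_tz^\perp&=-i|D|^\alpha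 z^\perp+\mathrm{Op}(im)z^\perp+\Pi^\perp X(z)+\Pi^\perp B(z).\end{aligned}\tag{1}$$ For $s>3\mathfrak s_0$, $0<\theta<\min\big(\frac{s-3\mathfrak s_0}{2s-\mathfrak s_0},\frac15\big)$, $T_\star>0$ and $\varepsilon\in(0,r)$, a solution $z\in C([0,T_\star];H^s)$ of (1), the equations being understood for each Fourier coefficient (and $V_4,a_4,B_1,B_2$ being extended arbitrarily to $\|z\|_{\mathfrak s_0}\ge r$), is called *long-time controlled* with parameters $(s,\theta,T_\star,\varepsilon)$ if $\|z^\top(0)\|_{L^2}\le\varepsilon$, $\|z^\perp(0)\|_{L^2}\le\varepsilon^3$ and $\sup_{0\le t\le T_\star}\|z(t)\|_s\le\varepsilon^{-\theta}$. **Lemma 5.3 (Bootstrap lemma).** For every $\theta>0$ and $T_0>0$ there is $\varepsilon_\star>0$, depending only on $\theta$, $T_0$ and the fixed system (1) (with its $\mathfrak s_0$, $r$), such that the following holds for all $s>3\mathfrak s_0$ with $\theta<\min\big(\frac{s-3\mathfrak s_0}{2s-\mathfrak s_0},\frac15\big)$ and all $\varepsilon\in(0,\varepsilon_\star)$. If $z(t)$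 is a solution of (1) that is long-time controlled with parameters $(s,\theta,T_\star,\varepsilon)$ and $T_\star\le\frac{T_0}{\varepsilon^2}\log\frac1\varepsilon$, then for all $0\le t\le T_\star$ $$\|z^\top(t)\|_{L^2}\le2\varepsilon,\qquad\|z^\perp(t)\|_{L^2}\le\varepsilon^{3-\frac32\theta},\qquad\|z(t)\|_{\mathfrak s_0}\le3\varepsilon,\qquad\|z^\perp(t)\|_{\mathfrak s_0}\le\varepsilon^2.$$ -/

import Mathlib

open Filter Topology MeasureTheory
open scoped ContDiff ComplexConjugate

noncomputable section

namespace QNLS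

/-! ### Sobolev spaces on the torus

A (generalised) function `u` on `𝕋 = ℝ / 2πℤ` is given by the sequence `u : ℤ → ℂ` of its Fourier
coefficients, `u(x) = ∑ k, u k * exp (i k x)`. -/

/-- The weight `⟨ξ⟩ = max (1, |ξ|)`. -/
def jap (ξ : ℝ) : ℝ := max 1 |ξ|

/-- `u ∈ H^s(𝕋, ℂ)`. -/
def MemHs (s : ℝ) (u : ℤ → ℂ) : Prop :=
  Summable fun k : ℤ => jap k ^ (2 * s) * ‖u k‖ ^ 2

/-- `‖u‖_s = (∑ k, ⟨k⟩^{2s} |u_k|²)^{1/2}`; the `L²` norm is the case `s = 0`. -/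
def hsNorm (s : ℝ) (u : ℤ → ℂ) : ℝ :=
  Real.sqrt (∑' k : ℤ, jap k ^ (2 * s) * ‖u k‖ ^ 2)

/-- The tangential part `z^⊤ = z_1 e^{ix} + z_{-1} e^{-ix}`. -/
def top (z : ℤ → ℂ) : ℤ → ℂ := fun k => if k = 1 ∨ k = -1 then z k else 0

/-- The normal part `z^⊥ = ∑_{|j| ≠ 1} z_j e^{ijx}`. -/
def perp (z : ℤ → ℂ) : ℤ → ℂ := fun k => if k = 1 ∨ k = -1 then 0 else z k

/-- Fourier coefficients of the complex conjugate function `conj z(x)`. -/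
def conjFun (z : ℤ → ℂ) : ℤ → ℂ := fun k => conj (z (-k))

/-- The translation `(τ_ς u)(x) = u(x + ς)`. -/
def translate (ς : ℝ) (u : ℤ → ℂ) : ℤ → ℂ := fun k => Complex.exp (Complex.I * k * ς) * u k

/-- Fourier coefficients `(2π)⁻¹ ∫₀^{2π} f(x) e^{-inx} dx` of a function of `x`. -/
def fourierC (f : ℝ → ℂ) (n : ℤ) : ℂ :=
  (1 / (2 * Real.pi) : ℝ) *
    ∫ x in (0 : ℝ)..(2 * Real.pi), f x * Complex.exp (-(Complex.I * n * x))

/-- `f ∈ W^{N,∞}(𝕋)` with `‖f‖_{W^{N,∞}} = ∑_{ℓ ≤ N} ‖∂_x^ℓ f‖_{L^∞} ≤ M`: `f` is continuous and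
`2π`-periodic, and for `ℓ ≤ N` its weak derivative of order `ℓ` (the function whose Fourier
coefficients are `(in)^ℓ f_n`) is a bounded function `g ℓ`, with `‖g ℓ‖_{L^∞} ≤ b ℓ`. -/
def WBound (N : ℕ) (f : ℝ → ℂ) (M : ℝ) : Prop :=
  Continuous f ∧ (∀ x, f (x + 2 * Real.pi) = f x) ∧
    ∃ (g : ℕ → ℝ → ℂ) (b : ℕ → ℝ),
      (∀ ℓ ≤ N,
        AEStronglyMeasurable (g ℓ) (volume.restrict (Set.Ioc 0 (2 * Real.pi))) ∧
        (∀ᵐ x ∂(volume.restrict (Set.Ioc 0 (2 * Real.pi))), ‖g ℓ x‖ ≤ b ℓ) ∧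
        ∀ n : ℤ, fourierC (g ℓ) n = (Complex.I * n) ^ ℓ * fourierC f n) ∧
      ∑ ℓ ∈ Finset.range (N + 1), b ℓ ≤ M

/-! ### Symbols

Symbols and operators that depend on `U = (u⁺, u⁻)` are only evaluated at real elements
`U = (z, conj z)`, so they are written as functions of `z`. -/

/-- An index `(j, σ)` with `j ∈ ℤ` and `σ = ±1`. -/
abbrev Idx : Type := ℤ × ℤˣ

/-- `u_j^σ` for `U = (z, conj z)`: it is `z_j` if `σ = +` and `conj z_j` if `σ = -`. -/
def amp (z : ℤ → ℂ) (i : Idx) : ℂ := if i.2 = 1 then z i.1 else conj (z i.1)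

/-- The momentum `σ j` of an index. -/
def mom (i : Idx) : ℤ := (i.2 : ℤ) * i.1

/-- A `2`-homogeneous symbol is given by its coefficients `a_{j₁,j₂}^{σ₁,σ₂}(ξ)`. Its value is
`a(U; x, ξ) = ∑ a_{j₁,j₂}^{σ₁,σ₂}(ξ) u_{j₁}^{σ₁} u_{j₂}^{σ₂} e^{i (σ₁ j₁ + σ₂ j₂) x}`. -/
def homEval (c : Idx → Idx → ℝ → ℂ) (z : ℤ → ℂ) (x ξ : ℝ) : ℂ :=
  ∑' i : Idx × Idx, c i.1 i.2 ξ * amp z i.1 * amp z i.2 *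
    Complex.exp (Complex.I * ((mom i.1 + mom i.2 : ℤ) : ℂ) * x)

/-- `2`-homogeneous symbols of order `m`, with growth exponent `μ` in the indices. -/
structure IsHomSymbol (m μ : ℝ) (c : Idx → Idx → ℝ → ℂ) : Prop where
  symm : ∀ i₁ i₂ ξ, c i₁ i₂ ξ = c i₂ i₁ ξ
  smooth : ∀ i₁ i₂, ContDiff ℝ ∞ (c i₁ i₂)
  bound : ∀ β : ℕ, ∃ C : ℝ, ∀ (i₁ i₂ : Idx) (ξ : ℝ),
    ‖iteratedDeriv β (c i₁ i₂) ξ‖ ≤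
      C * (max |(i₁.1 : ℝ)| |(i₂.1 : ℝ)|) ^ μ * jap ξ ^ (m - β)

/-- Non-homogeneous symbols of order `m` vanishing of degree `p` at `0`: the class
`Γ^m_{≥ p}[r]`, for functions defined on the ball `‖z‖_{s₀} < r`. -/
structure IsNonhomSymbol (s₀ r m : ℝ) (p : ℕ) (a : (ℤ → ℂ) → ℝ → ℝ → ℂ) : Prop where
  smooth : ∀ z, MemHs s₀ z → hsNorm s₀ z < r → ∀ x, ContDiff ℝ ∞ (a z x)
  periodic : ∀ z, MemHs s₀ z → hsNorm s₀ z < r → ∀ x ξ, a z (x + 2 * Real.pi) ξ = a z x ξ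
  bound : ∀ s : ℝ, s₀ ≤ s → ∃ r' : ℝ, 0 < r' ∧ r' < r ∧ ∀ β : ℕ, ∃ C : ℝ,
    ∀ z, MemHs s z → hsNorm s₀ z < r' → ∀ N : ℕ, (N : ℝ) ≤ s - s₀ → ∀ ξ : ℝ,
      WBound N (fun x => iteratedDeriv β (a z x) ξ)
        (C * jap ξ ^ (m - β) * hsNorm s₀ z ^ (p - 1) * hsNorm s z)
  transl : ∀ z, MemHs s₀ z → hsNorm s₀ z < r → ∀ ς x ξ : ℝ,
    a (translate ς z) x ξ = a z (x + ς) ξ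

/-! ### Paradifferential (Bony-Weyl) quantization -/

/-- Admissible cut-off functions `χ(ξ', ξ)` and `χ₂(ξ'₁, ξ'₂, ξ)`. -/
structure Cutoffs where
  δ : ℝ
  δ_pos : 0 < δ
  δ_le : δ ≤ 1 / 10
  χ : ℝ → ℝ → ℝ
  χ_smooth : ContDiff ℝ ∞ (fun q : ℝ × ℝ => χ q.1 q.2)
  χ_even_left : ∀ y ξ, χ (-y) ξ = χ y ξ
  χ_even_right : ∀ y ξ, χ y (-ξ) = χ y ξ
  χ_supp : ∀ y ξ, χ y ξ ≠ 0 → |y| ≤ δ * jap ξ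
  χ_one : ∀ y ξ, |y| ≤ δ * jap ξ / 2 → χ y ξ = 1
  χ_bound : ∀ ℓ β : ℕ, ∃ C : ℝ, ∀ y ξ,
    |iteratedDeriv ℓ (fun η => iteratedDeriv β (fun v => χ v η) y) ξ| ≤
      C * jap ξ ^ (-(ℓ : ℝ) - β)
  χ₂ : ℝ → ℝ → ℝ → ℝ
  χ₂_smooth : ContDiff ℝ ∞ (fun q : ℝ × ℝ × ℝ => χ₂ q.1 q.2.1 q.2.2)
  χ₂_even_one : ∀ y w ξ, χ₂ (-y) w ξ = χ₂ y w ξ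
  χ₂_even_two : ∀ y w ξ, χ₂ y (-w) ξ = χ₂ y w ξ
  χ₂_even_right : ∀ y w ξ, χ₂ y w (-ξ) = χ₂ y w ξ
  χ₂_supp : ∀ y w ξ, χ₂ y w ξ ≠ 0 → max |y| |w| ≤ δ * jap ξ
  χ₂_one : ∀ y w ξ, max |y| |w| ≤ δ * jap ξ / 2 → χ₂ y w ξ = 1
  χ₂_bound : ∀ ℓ β γ : ℕ, ∃ C : ℝ, ∀ y w ξ,
    |iteratedDeriv ℓ (fun η => iteratedDeriv β (fun v => iteratedDeriv γ
      (fun v' => χ₂ v v' η) w) y) ξ| ≤ C * jap ξ ^ (-(ℓ : ℝ) - β - γ)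

/-- `Op^BW(a(z; ·)) v` for a `2`-homogeneous symbol: its `k`-th Fourier coefficient is the sum over
`σ₁ j₁ + σ₂ j₂ + j = k` of
`χ₂(j₁, j₂, (j+k)/2) a_{j₁,j₂}^{σ₁,σ₂}((j+k)/2) u_{j₁}^{σ₁} u_{j₂}^{σ₂} v_j`. -/
def opHom (κ : Cutoffs) (c : Idx → Idx → ℝ → ℂ) (z v : ℤ → ℂ) : ℤ → ℂ := fun k =>
  ∑' i : Idx × Idx,
    let j : ℤ := k - mom i.1 - mom i.2
    let ξ : ℝ := ((j : ℝ) + k) / 2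
    (κ.χ₂ i.1.1 i.2.1 ξ : ℂ) * c i.1 i.2 ξ * amp z i.1 * amp z i.2 * v j

/-- `Op^BW(a) v` for a symbol `a(x, ξ)`: its `k`-th Fourier coefficient is
`∑ j, χ(k - j, (k+j)/2) â(k - j, (k+j)/2) v_j`. -/
def opNonhom (κ : Cutoffs) (a : ℝ → ℝ → ℂ) (v : ℤ → ℂ) : ℤ → ℂ := fun k =>
  ∑' j : ℤ,
    let ξ : ℝ := ((k : ℝ) + j) / 2
    (κ.χ ((k : ℝ) - j) ξ : ℂ) * fourierC (fun x => a x ξ) (k - j) * v j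

/-! ### Operators -/

/-- The second largest of three real numbers. -/
def max₂ (a b c : ℝ) : ℝ := max (min a b) (max (min b c) (min a c))

/-- Non-homogeneous `0`-operators `B(U)v`, linear in `v`, vanishing of degree `p` in `U`:
the class `M^0_{≥ p}[r]`. -/
structure IsNonhomOp (s₀ r : ℝ) (p : ℕ) (B : (ℤ → ℂ) → (ℤ → ℂ) → (ℤ → ℂ)) : Prop where
  map_add : ∀ z, MemHs s₀ z → hsNorm s₀ z < r → ∀ v w, MemHs s₀ v → MemHs s₀ w →
    B z (v + w) = B z v + B z w
  map_smul : ∀ z, MemHs s₀ z → hsNorm s₀ z < r → ∀ (c : ℂ) (v), MemHs s₀ v →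
    B z (c • v) = c • B z v
  bound : ∀ s : ℝ, s₀ ≤ s → ∃ C r' : ℝ, 0 < r' ∧ r' < r ∧
    ∀ z, MemHs s z → hsNorm s₀ z < r' → ∀ v, MemHs s v →
      MemHs s (B z v) ∧
      hsNorm s (B z v) ≤ C * (hsNorm s v * hsNorm s₀ z ^ p +
        hsNorm s₀ v * hsNorm s₀ z ^ (p - 1) * hsNorm s z)
  transl : ∀ z, MemHs s₀ z → hsNorm s₀ z < r → ∀ v, MemHs s₀ v → ∀ ς : ℝ,
    B (translate ς z) (translate ς v) = translate ς (B z v)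

/-- `2`-homogeneous, translation and gauge invariant, real-to-real matrices `R(U)` of smoothing
operators of order `-ϱ`. Such a matrix is determined by its first row, that is, by the coefficients
`R_{j₁,j₂,j,k}^{σ₁,σ₂,σ',+}` with `σ₁ + σ₂ + σ' = 1` and `k = σ₁ j₁ + σ₂ j₂ + σ' j`; the second row
is the complex conjugate of the first. -/
structure IsHomSmoothing (ϱ μ : ℝ) (R : Idx → Idx → Idx → ℂ) : Prop where
  symm : ∀ i₁ i₂ i₃, R i₁ i₂ i₃ = R i₂ i₁ i₃
  bound : ∃ C : ℝ, ∀ i₁ i₂ i₃ : Idx,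
    ‖R i₁ i₂ i₃‖ ≤ C * max₂ (jap i₁.1) (jap i₂.1) (jap i₃.1) ^ μ *
      max (jap i₁.1) (max (jap i₂.1) (jap i₃.1)) ^ (-ϱ)

/-- The number of indices among `j₁, j₂, j₃, k` outside `Λ = {1, -1}`. -/
def numOutside (i₁ i₂ i₃ : Idx) (k : ℤ) : ℕ :=
  (if i₁.1 = 1 ∨ i₁.1 = -1 then 0 else 1) + (if i₂.1 = 1 ∨ i₂.1 = -1 then 0 else 1) +
  (if i₃.1 = 1 ∨ i₃.1 = -1 then 0 else 1) + (if k = 1 ∨ k = -1 then 0 else 1)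

/-- The condition `((j₁, j₂, j₃, k), (σ₁, σ₂, σ₃, -)) ∈ 𝔓₄`. -/
def InP₄ (i₁ i₂ i₃ : Idx) (k : ℤ) : Prop :=
  mom i₁ + mom i₂ + mom i₃ = k ∧ ((i₁.2 : ℤ) + i₂.2 + i₃.2 = 1)

instance (i₁ i₂ i₃ : Idx) (k : ℤ) : Decidable (InP₄ i₁ i₂ i₃ k) := by
  unfold InP₄; infer_instance

/-- The first component of the cubic vector field `X(Z) = R(Z) Z` at `Z = (z, conj z)`. -/
def cubic (R : Idx → Idx → Idx → ℂ) (z : ℤ → ℂ) : ℤ → ℂ := fun k =>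
  ∑' i : Idx × Idx × Idx,
    if InP₄ i.1 i.2.1 i.2.2 k then
      R i.1 i.2.1 i.2.2 * amp z i.1 * amp z i.2.1 * amp z i.2.2 else 0

/-- The first component of the projection `Π_{𝔓_Λ^{(n)}} X` of `X(Z) = R(Z) Z` on the monomials with
exactly `n` of the indices `j₁, j₂, j₃, k` outside `Λ`. This set of indices is invariant under
permutations of the first three, so the coefficients need not be symmetrised first. -/
def cubicProj (n : ℕ) (R : Idx → Idx → Idx → ℂ) (z : ℤ → ℂ) : ℤ → ℂ := fun k =>
  ∑' i : Idx × Idx × Idx,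
    if InP₄ i.1 i.2.1 i.2.2 k ∧ numOutside i.1 i.2.1 i.2.2 k = n then
      R i.1 i.2.1 i.2.2 * amp z i.1 * amp z i.2.1 * amp z i.2.2 else 0

/-- The integrable vector field `-i |z_1|² z_1 e^{ix} + i |z_{-1}|² z_{-1} e^{-ix}`. -/
def yLam (z : ℤ → ℂ) : ℤ → ℂ := fun k =>
  if k = 1 then -Complex.I * (‖z 1‖ : ℂ) ^ 2 * z 1
  else if k = -1 then Complex.I * (‖z (-1)‖ : ℂ) ^ 2 * z (-1)
  else 0

/-- The coefficients of the `2`-homogeneous symbol `⟨V⟩(Z; x) ξ`, where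
`⟨V⟩(Z; x) = 2 Re ∑_{n ≥ 1} z_n conj(z_{-n}) e^{2inx} = ∑_{n ≠ 0} z_n conj(z_{-n}) e^{2inx}`.
The monomial `z_n conj(z_{-n})` is `u_n^+ u_{-n}^-`, and its coefficient `ξ` is shared equally by
the two orderings of its factors. -/
def resV : Idx → Idx → ℝ → ℂ := fun i₁ i₂ ξ =>
  if i₁.2 ≠ i₂.2 ∧ i₁.1 = -i₂.1 ∧ i₁.1 ≠ 0 then (ξ : ℂ) / 2 else 0

/-! ### The normal form system -/

/-- The ingredients of the normal form equation
`∂_t Z = -iΩ(D)Z + Op^BW(i⟨V⟩ξ + i a₂)Z + R(Z)Z + Op^BW(i V₄ ξ + i a₄)Z + B(Z)Z`, where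
`Z = (z, conj z)` and `s₀` is large with respect to the growth exponents of `a₂` and `R`.
`B₁`, `B₂` form the first row of the real-to-real matrix `B`. -/
structure NormalForm (α s₀ r : ℝ) where
  /-- a real, gauge invariant symbol of order `α` with zero average -/
  a₂ : Idx → Idx → ℝ → ℂ
  μa : ℝ
  μa_nonneg : 0 ≤ μa
  μa_le : μa + 1 ≤ s₀
  a₂_symbol : IsHomSymbol α μa a₂
  a₂_real : ∀ z, MemHs s₀ z → ∀ x ξ, (homEval a₂ z x ξ).im = 0
  a₂_gauge : ∀ z, MemHs s₀ z → ∀ ϑ x ξ : ℝ,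
    homEval a₂ (fun k => Complex.exp (Complex.I * ϑ) * z k) x ξ = homEval a₂ z x ξ
  a₂_average : ∀ z, MemHs s₀ z → ∀ ξ : ℝ, fourierC (fun x => homEval a₂ z x ξ) 0 = 0
  /-- a real function, vanishing of degree four -/
  V₄ : (ℤ → ℂ) → ℝ → ℂ
  V₄_symbol : IsNonhomSymbol s₀ r 0 4 (fun z x _ => V₄ z x)
  V₄_real : ∀ z, MemHs s₀ z → hsNorm s₀ z < r → ∀ x, (V₄ z x).im = 0
  /-- a real symbol of order `α`, vanishing of degree four -/
  a₄ : (ℤ → ℂ) → ℝ → ℝ → ℂ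
  a₄_symbol : IsNonhomSymbol s₀ r α 4 a₄
  a₄_real : ∀ z, MemHs s₀ z → hsNorm s₀ z < r → ∀ x ξ, (a₄ z x ξ).im = 0
  /-- smoothing operators whose cubic vector field is in strong `Λ`-normal form -/
  R : Idx → Idx → Idx → ℂ
  μR : ℝ
  μR_nonneg : 0 ≤ μR
  μR_le : μR + 1 ≤ s₀
  R_smoothing : IsHomSmoothing 4 μR R
  R_zero : ∀ z, MemHs s₀ z → cubicProj 0 R z = yLam z
  R_one : ∀ z, MemHs s₀ z → cubicProj 1 R z = 0
  R_two : ∀ z, MemHs s₀ z → cubicProj 2 R z = 0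
  /-- bounded operators, vanishing of degree four -/
  B₁ : (ℤ → ℂ) → (ℤ → ℂ) → (ℤ → ℂ)
  B₂ : (ℤ → ℂ) → (ℤ → ℂ) → (ℤ → ℂ)
  B₁_op : IsNonhomOp s₀ r 4 B₁
  B₂_op : IsNonhomOp s₀ r 4 B₂

namespace NormalForm

variable {α s₀ r : ℝ} (S : NormalForm α s₀ r) (κ : Cutoffs)

/-- The `2`-homogeneous part `⟨V⟩ξ + a₂` of the symbol `m`, multiplied by `i`. -/
def im₂ : Idx → Idx → ℝ → ℂ := fun i₁ i₂ ξ => Complex.I * (resV i₁ i₂ ξ + S.a₂ i₁ i₂ ξ)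

/-- The non-homogeneous part `m_{≥4} = V₄ξ + a₄` of the symbol `m`, multiplied by `i`. -/
def im₄ (z : ℤ → ℂ) : ℝ → ℝ → ℂ := fun x ξ => Complex.I * (S.V₄ z x * ξ + S.a₄ z x ξ)

/-- `Op^BW(i m(z; x, ξ)) v`. -/
def opM (z v : ℤ → ℂ) : ℤ → ℂ := opHom κ S.im₂ z v + opNonhom κ (S.im₄ z) v

/-- First component of `B(Z) Z`. -/
def bZ (z : ℤ → ℂ) : ℤ → ℂ := S.B₁ z z + S.B₂ z (conjFun z)

def y3Top (z : ℤ → ℂ) : ℤ → ℂ := top (cubic S.R z - cubicProj 0 S.R z)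

def y3Perp (z : ℤ → ℂ) : ℤ → ℂ := perp (cubic S.R z)

def y5Top (z : ℤ → ℂ) : ℤ → ℂ := top (S.bZ z) + top (opNonhom κ (S.im₄ z) (top z))

def y5Perp (z : ℤ → ℂ) : ℤ → ℂ := perp (S.bZ z)

/-- `-i |D|^α v`. -/
def disp (α : ℝ) (v : ℤ → ℂ) : ℤ → ℂ := fun k => -Complex.I * ((|(k : ℝ)| ^ α : ℝ) : ℂ) * v k

/-- Right-hand side of the equation for `z^⊤`. -/
def rhsTop (z : ℤ → ℂ) : ℤ → ℂ :=
  disp α (top z) + yLam (top z) + S.y3Top z + S.y5Top κ z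

/-- Right-hand side of the equation for `z^⊥`. -/
def rhsPerp (z : ℤ → ℂ) : ℤ → ℂ :=
  disp α (perp z) + S.opM κ z (perp z) + S.y3Perp z + S.y5Perp z

/-- `z ∈ C([0,T]; H^s)` solves the system for `(z^⊤, z^⊥)` on `[0,T]`, in the sense that the equation
holds for every Fourier coefficient. Solutions that stay in the ball `‖z‖_{s₀} < r`, where the
non-homogeneous terms are meaningful, are a special case. -/
structure IsSolution (s T : ℝ) (z : ℝ → ℤ → ℂ) : Prop where
  mem : ∀ t ∈ Set.Icc 0 T, MemHs s (z t)
  cont : ∀ t ∈ Set.Icc 0 T,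
    Tendsto (fun τ => hsNorm s (z τ - z t)) (𝓝[Set.Icc 0 T] t) (𝓝 0)
  eq_top : ∀ t ∈ Set.Icc 0 T, ∀ k : ℤ,
    HasDerivWithinAt (fun τ => top (z τ) k) (S.rhsTop κ (z t) k) (Set.Icc 0 T) t
  eq_perp : ∀ t ∈ Set.Icc 0 T, ∀ k : ℤ,
    HasDerivWithinAt (fun τ => perp (z τ) k) (S.rhsPerp κ (z t) k) (Set.Icc 0 T) t

/-- Long-time controlled solutions with parameters `(s, θ, T, ε)`. -/
structure LongTimeControlled (s θ T ε : ℝ) (z : ℝ → ℤ → ℂ) : Prop where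
  T_pos : 0 < T
  ε_pos : 0 < ε
  ε_lt : ε < r
  sol : S.IsSolution κ s T z
  init_top : hsNorm 0 (top (z 0)) ≤ ε
  init_perp : hsNorm 0 (perp (z 0)) ≤ ε ^ 3
  high : ∀ t ∈ Set.Icc 0 T, hsNorm s (z t) ≤ ε ^ (-θ)

end NormalForm

end QNLS

end

/-! The proof is an `L²` energy estimate for the two components of `z`, closed by continuity in
time; the high norm enters only through interpolation.

In `Re ⟨z^⊤, ∂_t z^⊤⟩` and `Re ⟨z^⊥, ∂_t z^⊥⟩` the large terms cancel. The dispersion and the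
integrable field multiply each coefficient by an imaginary number (`pair_disp`, `pair_yLam`). The
paradifferential terms have symbols `i` times real, and the Weyl quantization turns these into
skew-adjoint operators (`opHom_skew`, `opNonhom_skew`), so their first order costs nothing. For the
homogeneous symbol, reality of the values must first be converted into reality of the coefficients
(`conj_coeff_of_real`).

Two contributions survive. After removing `Π₀X`, the cubic field contains only monomials with at
least three indices outside `Λ`, hence with two normal factors (`exists_cubic_bound`); the other is
the quintic field `B`. With `‖z‖_{s₀} ≤ 3ε` and `‖z^⊥‖_{s₀} ≤ ε²` both have size `ε⁵`. Over a time
`ε⁻² log(1/ε)`, the quantity `‖z^⊤‖²` grows by `O(ε⁴ log(1/ε))`, much less than `ε²`. With `b = ε^(3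
- 3θ/2)`, the quantity `‖z^⊥‖²` grows by `O(b ε³ log(1/ε))`, which is `O(b² ε^(θ/2))` because `ε³ =
b ε^(3θ/2)` and `ε^θ log(1/ε)` is bounded.

The `s₀` bounds follow from the `L²` ones: the weight is `1` on `Λ`, and `z^⊥` is interpolated
between `L²` and `H^s` (`hsNorm_le_sq_of_interpolation`), where the upper bound on `θ` in terms of
`s` is used. Thus the `L²` bounds improve themselves strictly, and `continuous_bootstrap` concludes.
All constants come from estimates at the fixed regularity `s₀`, so the threshold for `ε` does not
depend on `s`. -/

noncomputable section

namespace QNLS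

/-! ### The weight -/

lemma one_le_jap (ξ : ℝ) : 1 ≤ jap ξ := le_max_left _ _

lemma jap_pos (ξ : ℝ) : 0 < jap ξ := zero_lt_one.trans_le (one_le_jap ξ)

lemma abs_le_jap (ξ : ℝ) : |ξ| ≤ jap ξ := le_max_right _ _

lemma jap_neg (ξ : ℝ) : jap (-ξ) = jap ξ := by simp [jap]

/-- Weyl symbols are evaluated at the midpoint of the two frequencies; this separates the variables.
-/
lemma jap_half_add_le (a b : ℝ) : jap ((a + b) / 2) ≤ jap a * jap b := by
  have ha := one_le_jap a
  have hb := one_le_jap b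
  refine max_le (one_le_mul_of_one_le_of_one_le ha hb) ?_
  rw [abs_div, abs_two]
  have := abs_add_le a b
  have := abs_le_jap a
  have := abs_le_jap b
  nlinarith

lemma jap_eq_one {k : ℤ} (hk : k = 1 ∨ k = -1) : jap k = 1 := by
  rcases hk with rfl | rfl <;> simp [jap]

lemma jap_rpow_pos (ξ s : ℝ) : 0 < jap ξ ^ s := Real.rpow_pos_of_pos (jap_pos ξ) s

lemma jap_rpow_mono (ξ : ℝ) {s s' : ℝ} (h : s ≤ s') : jap ξ ^ s ≤ jap ξ ^ s' :=
  Real.rpow_le_rpow_of_exponent_le (one_le_jap ξ) h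

lemma summable_jap_neg_two : Summable fun k : ℤ => jap k ^ (-2 : ℝ) := by
  have h : Summable fun k : ℤ => |(k : ℝ)| ^ (-2 : ℝ) :=
    Real.summable_abs_int_rpow (by norm_num)
  refine (h.add (summable_of_hasFiniteSupport (f := fun k : ℤ => if k = 0 then (1 : ℝ) else 0)
    ((Set.finite_singleton 0).subset fun k hk => ?_))).of_nonneg_of_le
    (fun k => (jap_rpow_pos _ _).le) fun k => ?_
  · by_contra h; simp_all
  · rcases eq_or_ne k 0 with rfl | hk
    · simp [jap]
    · have : (1 : ℝ) ≤ |(k : ℝ)| := by exact_mod_cast Int.one_le_abs hk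
      simp [hk, jap, max_eq_right this]

/-- The constant of the embedding `H^{μ+1} ⊆ FL^{1,μ}`. -/
def embConst : ℝ := Real.sqrt (∑' k : ℤ, jap k ^ (-2 : ℝ))

lemma embConst_nonneg : 0 ≤ embConst := Real.sqrt_nonneg _

/-! ### Sobolev norms -/

lemma hsNorm_nonneg (s : ℝ) (u : ℤ → ℂ) : 0 ≤ hsNorm s u := Real.sqrt_nonneg _

lemma hsTerm_nonneg (s : ℝ) (u : ℤ → ℂ) (k : ℤ) : 0 ≤ jap k ^ (2 * s) * ‖u k‖ ^ 2 := by
  have := jap_rpow_pos k (2 * s)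
  positivity

lemma hsNorm_sq (s : ℝ) (u : ℤ → ℂ) :
    hsNorm s u ^ 2 = ∑' k : ℤ, jap k ^ (2 * s) * ‖u k‖ ^ 2 :=
  Real.sq_sqrt (tsum_nonneg fun k => hsTerm_nonneg s u k)

lemma hsNorm_zero_sq (u : ℤ → ℂ) : hsNorm 0 u ^ 2 = ∑' k : ℤ, ‖u k‖ ^ 2 := by
  simp [hsNorm_sq]

lemma MemHs.mono_of_norm_le {s : ℝ} {u v : ℤ → ℂ} (hu : MemHs s u) (h : ∀ k, ‖v k‖ ≤ ‖u k‖) :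
    MemHs s v :=
  hu.of_nonneg_of_le (hsTerm_nonneg s v) fun k => by
    have := (jap_rpow_pos k (2 * s)).le
    have := h k
    gcongr

lemma hsNorm_le_of_norm_le {s : ℝ} {u v : ℤ → ℂ} (hu : MemHs s u) (h : ∀ k, ‖v k‖ ≤ ‖u k‖) :
    hsNorm s v ≤ hsNorm s u :=
  Real.sqrt_le_sqrt <| (hu.mono_of_norm_le h).tsum_le_tsum (fun k => by
    have := (jap_rpow_pos k (2 * s)).le
    have := h k
    gcongr) hu

lemma hsTerm_mono {s s' : ℝ} (h : s ≤ s') (u : ℤ → ℂ) (k : ℤ) :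
    jap k ^ (2 * s) * ‖u k‖ ^ 2 ≤ jap k ^ (2 * s') * ‖u k‖ ^ 2 :=
  mul_le_mul_of_nonneg_right (jap_rpow_mono _ (by linarith)) (by positivity)

lemma MemHs.mono {s s' : ℝ} {u : ℤ → ℂ} (hu : MemHs s' u) (h : s ≤ s') : MemHs s u :=
  hu.of_nonneg_of_le (hsTerm_nonneg s u) (hsTerm_mono h u)

lemma hsNorm_mono {s s' : ℝ} {u : ℤ → ℂ} (hu : MemHs s' u) (h : s ≤ s') :
    hsNorm s u ≤ hsNorm s' u :=
  Real.sqrt_le_sqrt <| (hu.mono h).tsum_le_tsum (hsTerm_mono h u) hu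

lemma norm_top_le (u : ℤ → ℂ) (k : ℤ) : ‖top u k‖ ≤ ‖u k‖ := by
  unfold top; split_ifs <;> simp

lemma norm_perp_le (u : ℤ → ℂ) (k : ℤ) : ‖perp u k‖ ≤ ‖u k‖ := by
  unfold perp; split_ifs <;> simp

/-- Since `⟨±1⟩ = 1`, an `L²` bound on the tangential part is an `H^{s₀}` bound without loss. -/
lemma hsNorm_top (s : ℝ) (u : ℤ → ℂ) : hsNorm s (top u) = hsNorm 0 (top u) := by
  unfold hsNorm
  congr 2
  funext k
  by_cases hk : k = 1 ∨ k = -1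
  · simp [jap_eq_one hk]
  · simp [top, hk]

lemma hsNorm_sq_eq_top_add_perp {s : ℝ} {u : ℤ → ℂ} (hu : MemHs s u) :
    hsNorm s u ^ 2 = hsNorm s (top u) ^ 2 + hsNorm s (perp u) ^ 2 := by
  rw [hsNorm_sq, hsNorm_sq, hsNorm_sq,
    ← (hu.mono_of_norm_le (norm_top_le u)).tsum_add (hu.mono_of_norm_le (norm_perp_le u))]
  congr 1
  funext k
  by_cases hk : k = 1 ∨ k = -1 <;> simp [top, perp, hk]

lemma norm_conjFun_summand (s : ℝ) (u : ℤ → ℂ) (k : ℤ) :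
    jap k ^ (2 * s) * ‖conjFun u k‖ ^ 2 =
      (fun k : ℤ => jap k ^ (2 * s) * ‖u k‖ ^ 2) (Equiv.neg ℤ k) := by
  simp [conjFun, jap_neg]

lemma MemHs.conjFun {s : ℝ} {u : ℤ → ℂ} (hu : MemHs s u) : MemHs s (conjFun u) := by
  unfold MemHs
  simp_rw [norm_conjFun_summand]
  exact (Equiv.neg ℤ).summable_iff.2 hu

lemma hsNorm_conjFun (s : ℝ) (u : ℤ → ℂ) : hsNorm s (conjFun u) = hsNorm s u := by
  unfold hsNorm
  simp_rw [norm_conjFun_summand]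
  rw [(Equiv.neg ℤ).tsum_eq (fun k : ℤ => jap k ^ (2 * s) * ‖u k‖ ^ 2)]

lemma norm_coeff_le {s : ℝ} {u : ℤ → ℂ} (hu : MemHs s u) (k : ℤ) :
    ‖u k‖ ≤ hsNorm s u * jap k ^ (-s) := by
  have h1 : jap k ^ (2 * s) * ‖u k‖ ^ 2 ≤ hsNorm s u ^ 2 := by
    rw [hsNorm_sq]; exact hu.le_tsum k fun j _ => hsTerm_nonneg s u j
  have h2 : (jap k ^ s * ‖u k‖) ^ 2 ≤ hsNorm s u ^ 2 := by
    rwa [mul_pow, ← Real.rpow_natCast, ← Real.rpow_mul (jap_pos _).le, mul_comm s]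
  have h3 := (pow_le_pow_iff_left₀ (mul_nonneg (jap_rpow_pos _ _).le (norm_nonneg _))
    (hsNorm_nonneg s u) two_ne_zero).1 h2
  rw [Real.rpow_neg (jap_pos _).le, ← div_eq_mul_inv, le_div_iff₀ (jap_rpow_pos _ _)]
  linarith

/-- Cauchy–Schwarz applied to `⟨k⟩^μ = ⟨k⟩⁻¹ ⟨k⟩^(μ+1)`. -/
lemma summable_and_tsum_jap_mul_norm_le {μ s : ℝ} (hμ : μ + 1 ≤ s) {u : ℤ → ℂ} (hu : MemHs s u) :
    (Summable fun k : ℤ => jap k ^ μ * ‖u k‖) ∧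
      ∑' k : ℤ, jap k ^ μ * ‖u k‖ ≤ embConst * hsNorm s u := by
  have hf : ∀ k : ℤ, (0 : ℝ) ≤ jap k ^ (-1 : ℝ) := fun k => (jap_rpow_pos _ _).le
  have hg : ∀ k : ℤ, 0 ≤ jap k ^ (μ + 1) * ‖u k‖ := fun k =>
    mul_nonneg (jap_rpow_pos _ _).le (norm_nonneg _)
  have ef : ∀ k : ℤ, (jap k ^ (-1 : ℝ)) ^ (2 : ℝ) = jap k ^ (-2 : ℝ) := fun k => by
    rw [← Real.rpow_mul (jap_pos _).le]; norm_num
  have eg : ∀ k : ℤ, (jap k ^ (μ + 1) * ‖u k‖) ^ (2 : ℝ) =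
      jap k ^ (2 * (μ + 1)) * ‖u k‖ ^ 2 := fun k => by
    rw [Real.mul_rpow (jap_rpow_pos _ _).le (norm_nonneg _), ← Real.rpow_mul (jap_pos _).le,
      mul_comm (μ + 1)]
    norm_num
  have efg : ∀ k : ℤ, jap k ^ (-1 : ℝ) * (jap k ^ (μ + 1) * ‖u k‖) = jap k ^ μ * ‖u k‖ :=
    fun k => by
      rw [← mul_assoc, ← Real.rpow_add (jap_pos _)]; ring_nf
  have hu' : MemHs (μ + 1) u := hu.mono hμ
  have sf : Summable fun k : ℤ => (jap k ^ (-1 : ℝ)) ^ (2 : ℝ) := by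
    simp_rw [ef]; exact summable_jap_neg_two
  have sg : Summable fun k : ℤ => (jap k ^ (μ + 1) * ‖u k‖) ^ (2 : ℝ) := by
    simp_rw [eg]; exact hu'
  have key := Real.inner_le_Lp_mul_Lq_tsum_of_nonneg Real.HolderConjugate.two_two hf hg sf sg
  have ks := Real.summable_mul_of_Lp_Lq_of_nonneg Real.HolderConjugate.two_two hf hg sf sg
  simp_rw [ef, eg, efg, ← Real.sqrt_eq_rpow] at key
  simp_rw [efg] at ks
  exact ⟨ks, key.trans (mul_le_mul_of_nonneg_left (hsNorm_mono hu hμ) embConst_nonneg)⟩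

/-- Frequencies with `⟨k⟩ ≤ N` are charged to `L²`, the others to `H^s`. Leaving `N` free gives
interpolation once it is chosen to balance the two terms. -/
lemma hsNorm_sq_le_split {s₀ s N : ℝ} (hs₀ : 0 ≤ s₀) (hs : s₀ ≤ s) (hN : 0 < N) {u : ℤ → ℂ}
    (hu : MemHs s u) :
    hsNorm s₀ u ^ 2 ≤
      N ^ (2 * s₀) * hsNorm 0 u ^ 2 + N ^ (2 * s₀ - 2 * s) * hsNorm s u ^ 2 := by
  have hu0 : MemHs 0 u := hu.mono (hs₀.trans hs)
  rw [hsNorm_sq, hsNorm_sq, hsNorm_sq, ← tsum_mul_left, ← tsum_mul_left,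
    ← (hu0.mul_left _).tsum_add (hu.mul_left _)]
  refine (hu.mono hs).tsum_le_tsum (fun k => ?_) ((hu0.mul_left _).add (hu.mul_left _))
  rw [← mul_assoc, ← mul_assoc, ← add_mul]
  refine mul_le_mul_of_nonneg_right ?_ (by positivity)
  have h1 : 0 < N ^ (2 * s₀) := Real.rpow_pos_of_pos hN _
  have h2 : 0 < N ^ (2 * s₀ - 2 * s) := Real.rpow_pos_of_pos hN _
  have h3 := jap_rpow_pos k (2 * s)
  simp only [mul_zero, Real.rpow_zero, mul_one]
  rcases le_total (jap k) N with h | h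
  · have := Real.rpow_le_rpow (jap_pos k).le h (by linarith : 0 ≤ 2 * s₀)
    nlinarith [mul_pos h2 h3]
  · have : jap k ^ (2 * s₀ - 2 * s) ≤ N ^ (2 * s₀ - 2 * s) :=
      Real.rpow_le_rpow_of_nonpos hN h (by linarith)
    have e : jap (k : ℝ) ^ (2 * s₀) = jap k ^ (2 * s₀ - 2 * s) * jap k ^ (2 * s) := by
      rw [← Real.rpow_add (jap_pos _)]; ring_nf
    rw [e]
    nlinarith

/-! ### Conjugate indices and reality of homogeneous symbols -/

/-- The index `(j, -σ)`. -/
def barIdx : Idx ≃ Idx where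
  toFun i := (i.1, -i.2)
  invFun i := (i.1, -i.2)
  left_inv i := by simp
  right_inv i := by simp

lemma conj_amp (z : ℤ → ℂ) (i : Idx) : conj (amp z i) = amp z (barIdx i) := by
  obtain ⟨j, σ⟩ := i
  rcases Int.units_eq_one_or σ with rfl | rfl <;> simp [amp, barIdx]

lemma norm_amp (z : ℤ → ℂ) (i : Idx) : ‖amp z i‖ = ‖z i.1‖ := by
  unfold amp; split_ifs <;> simp

lemma mom_barIdx (i : Idx) : mom (barIdx i) = -mom i := by simp [mom, barIdx]

lemma amp_add (z w : ℤ → ℂ) (i : Idx) : amp (z + w) i = amp z i + amp w i := by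
  unfold amp; split_ifs <;> simp

/-- The quadratic form `∑ d_{j₁,j₂}^{σ₁,σ₂} u_{j₁}^{σ₁} u_{j₂}^{σ₂}`, in polarised form. -/
def ampForm (d : Idx → Idx → ℂ) (z w : ℤ → ℂ) : ℂ :=
  ∑' i : Idx × Idx, d i.1 i.2 * amp z i.1 * amp w i.2

lemma support_amp_finite {z : ℤ → ℂ} (hz : z.support.Finite) :
    (Function.support (amp z)).Finite := by
  refine (hz.prod (Set.finite_univ (α := ℤˣ))).subset fun i hi => ⟨?_, trivial⟩
  have : ‖amp z i‖ ≠ 0 := by simpa using hi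
  rw [norm_amp] at this
  simpa using this

lemma summable_ampForm (d : Idx → Idx → ℂ) {z w : ℤ → ℂ} (hz : z.support.Finite)
    (hw : w.support.Finite) :
    Summable fun i : Idx × Idx => d i.1 i.2 * amp z i.1 * amp w i.2 := by
  refine summable_of_hasFiniteSupport
    (((support_amp_finite hz).prod (support_amp_finite hw)).subset fun i hi => ?_)
  simp only [Function.mem_support, ne_eq, mul_eq_zero, not_or] at hi
  exact ⟨hi.1.2, hi.2⟩

lemma ampForm_comm {d : Idx → Idx → ℂ} (hd : ∀ i j, d i j = d j i) (z w : ℤ → ℂ) :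
    ampForm d z w = ampForm d w z := by
  unfold ampForm
  rw [← (Equiv.prodComm Idx Idx).tsum_eq]
  refine tsum_congr fun i => ?_
  simp [hd i.2 i.1]; ring

/-- Polarisation. It needs only additivity in each argument, which matters because the amplitudes
are real-linear but not complex-linear in `z`. -/
lemma ampForm_eq_zero_of_diag {d : Idx → Idx → ℂ} (hd : ∀ i j, d i j = d j i)
    (h : ∀ z : ℤ → ℂ, z.support.Finite → ampForm d z z = 0) {z w : ℤ → ℂ}
    (hz : z.support.Finite) (hw : w.support.Finite) : ampForm d z w = 0 := by
  have hzw : (z + w).support.Finite := (hz.union hw).subset (Function.support_add z w)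
  have e : ampForm d (z + w) (z + w) =
      (ampForm d z z + ampForm d z w) + (ampForm d w z + ampForm d w w) := by
    unfold ampForm
    rw [← (summable_ampForm d hz hz).tsum_add (summable_ampForm d hz hw),
      ← (summable_ampForm d hw hz).tsum_add (summable_ampForm d hw hw),
      ← ((summable_ampForm d hz hz).add (summable_ampForm d hz hw)).tsum_add
        ((summable_ampForm d hw hz).add (summable_ampForm d hw hw))]
    refine tsum_congr fun i => ?_
    rw [amp_add, amp_add]; ring
  rw [h _ hzw, h _ hz, h _ hw, ampForm_comm hd w z] at e
  have : (2 : ℂ) * ampForm d z w = 0 := by linear_combination -e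
  simpa using this

lemma ampForm_single (d : Idx → Idx → ℂ) (j₁ j₂ : ℤ) (w₁ w₂ : ℂ) :
    ampForm d (Pi.single j₁ w₁) (Pi.single j₂ w₂) =
      d (j₁, 1) (j₂, 1) * w₁ * w₂ + d (j₁, 1) (j₂, -1) * w₁ * conj w₂ +
      d (j₁, -1) (j₂, 1) * conj w₁ * w₂ + d (j₁, -1) (j₂, -1) * conj w₁ * conj w₂ := by
  unfold ampForm
  rw [tsum_eq_sum (s := (({j₁} : Finset ℤ) ×ˢ (Finset.univ : Finset ℤˣ)) ×ˢ
    (({j₂} : Finset ℤ) ×ˢ (Finset.univ : Finset ℤˣ)))]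
  · have hne : (-1 : ℤˣ) ≠ 1 := by decide
    have hu : (Finset.univ : Finset ℤˣ) = {1, -1} := rfl
    rw [Finset.sum_product, hu]
    simp only [Finset.sum_product, Finset.sum_singleton, Finset.sum_pair hne.symm]
    simp [amp, hne]
    ring
  · intro i hi
    by_contra h0
    simp only [mul_eq_zero, not_or] at h0
    have h1 : ‖amp (Pi.single j₁ w₁) i.1‖ ≠ 0 := by simpa using h0.1.2
    have h2 : ‖amp (Pi.single j₂ w₂) i.2‖ ≠ 0 := by simpa using h0.2
    rw [norm_amp] at h1 h2
    have e1 : i.1.1 = j₁ := by by_contra h; simp [h] at h1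
    have e2 : i.2.1 = j₂ := by by_contra h; simp [h] at h2
    refine hi ?_
    simp only [Finset.mem_product, Finset.mem_singleton, Finset.mem_univ, and_true]
    exact ⟨e1, e2⟩

lemma support_single_finite (j : ℤ) (w : ℂ) :
    (Function.support (Pi.single j w : ℤ → ℂ)).Finite :=
  (Set.finite_singleton j).subset fun k hk => by
    by_contra h; simp_all [Pi.single_apply]

/-- A symmetric quadratic form in `(z, conj z)` that vanishes identically has zero coefficients. -/
lemma coeff_eq_zero_of_ampForm_diag {d : Idx → Idx → ℂ} (hd : ∀ i j, d i j = d j i)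
    (h : ∀ z : ℤ → ℂ, z.support.Finite → ampForm d z z = 0) (i₁ i₂ : Idx) : d i₁ i₂ = 0 := by
  obtain ⟨j₁, σ₁⟩ := i₁
  obtain ⟨j₂, σ₂⟩ := i₂
  have key : ∀ w₁ w₂ : ℂ, _ := fun w₁ w₂ => (ampForm_single d j₁ j₂ w₁ w₂).symm.trans
    (ampForm_eq_zero_of_diag hd h (support_single_finite j₁ w₁) (support_single_finite j₂ w₂))
  -- In each variable the form is `w d₊ + conj w d₋`, and its values at `w = 1` and `w = i`
  -- determine `d₊` and `d₋`. The four tests therefore determine the four coefficients.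
  have h11 := key 1 1
  have h1i := key 1 Complex.I
  have hi1 := key Complex.I 1
  have hii := key Complex.I Complex.I
  simp only [map_one, Complex.conj_I] at h11 h1i hi1 hii
  have hI := Complex.I_sq
  have e1 : d (j₁, 1) (j₂, 1) + d (j₁, 1) (j₂, -1) = 0 := by
    linear_combination h11 / 2 - Complex.I / 2 * hi1 + (1 / 2) * hI *
      (d (j₁, 1) (j₂, 1) + d (j₁, 1) (j₂, -1) - d (j₁, -1) (j₂, 1) - d (j₁, -1) (j₂, -1))
  have e2 : d (j₁, -1) (j₂, 1) + d (j₁, -1) (j₂, -1) = 0 := by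
    linear_combination h11 - e1
  have e3 : d (j₁, 1) (j₂, 1) - d (j₁, 1) (j₂, -1) = 0 := by
    linear_combination -Complex.I * h1i / 2 - hii / 2 + hI *
      (d (j₁, 1) (j₂, 1) - d (j₁, 1) (j₂, -1))
  have e4 : d (j₁, -1) (j₂, 1) - d (j₁, -1) (j₂, -1) = 0 := by
    linear_combination -Complex.I * h1i - e3 + hI *
      (d (j₁, 1) (j₂, 1) - d (j₁, 1) (j₂, -1) + d (j₁, -1) (j₂, 1) - d (j₁, -1) (j₂, -1))
  rcases Int.units_eq_one_or σ₁ with rfl | rfl <;> rcases Int.units_eq_one_or σ₂ with rfl | rfl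
  · linear_combination (e1 + e3) / 2
  · linear_combination (e1 - e3) / 2
  · linear_combination (e2 + e4) / 2
  · linear_combination (e2 - e4) / 2

lemma memHs_of_finite {z : ℤ → ℂ} (hz : z.support.Finite) (s : ℝ) : MemHs s z :=
  summable_of_hasFiniteSupport (hz.subset fun k hk => by
    by_contra h; simp_all)

/-- The coefficients of a real valued symbol satisfy the reality condition. -/
lemma conj_coeff_of_real {c : Idx → Idx → ℝ → ℂ} {s₀ : ℝ} (hc : ∀ i₁ i₂ ξ, c i₁ i₂ ξ = c i₂ i₁ ξ)
    (hr : ∀ z, MemHs s₀ z → ∀ x ξ, (homEval c z x ξ).im = 0) (i₁ i₂ : Idx) (ξ : ℝ) :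
    conj (c i₁ i₂ ξ) = c (barIdx i₁) (barIdx i₂) ξ := by
  have key := coeff_eq_zero_of_ampForm_diag
    (d := fun i j => conj (c (barIdx i) (barIdx j) ξ) - c i j ξ)
    (fun i j => by rw [hc i j, hc (barIdx i)]) (fun z hz => ?_) (barIdx i₁) (barIdx i₂)
  · have e : ∀ i, barIdx (barIdx i) = i := barIdx.left_inv
    rw [e, e] at key
    exact sub_eq_zero.1 key
  -- At `x = 0` the exponentials disappear and the symbol is a quadratic form in `(z, conj z)`.
  -- Finitely supported `z` suffice, and for them all sums are finite.
  · have h1 : homEval c z 0 ξ = ampForm (fun i j => c i j ξ) z z := by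
      unfold homEval ampForm; simp
    have h2 : conj (ampForm (fun i j => c i j ξ) z z) =
        ampForm (fun i j => conj (c (barIdx i) (barIdx j) ξ)) z z := by
      unfold ampForm
      rw [Complex.conj_tsum, ← (barIdx.prodCongr barIdx).tsum_eq]
      refine tsum_congr fun i => ?_
      simp [conj_amp, barIdx]
    have h3 := Complex.conj_eq_iff_im.2 (hr z (memHs_of_finite hz s₀) 0 ξ)
    rw [h1, h2] at h3
    have h4 : ampForm (fun i j => conj (c (barIdx i) (barIdx j) ξ) - c i j ξ) z z =
        ampForm (fun i j => conj (c (barIdx i) (barIdx j) ξ)) z z -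
          ampForm (fun i j => c i j ξ) z z := by
      unfold ampForm
      rw [← (summable_ampForm (fun i j => conj (c (barIdx i) (barIdx j) ξ)) hz hz).tsum_sub
        (summable_ampForm (fun i j => c i j ξ) hz hz)]
      refine tsum_congr fun i => ?_
      ring
    rw [h4, h3, sub_self]

lemma conj_resV (i₁ i₂ : Idx) (ξ : ℝ) :
    conj (resV i₁ i₂ ξ) = resV (barIdx i₁) (barIdx i₂) ξ := by
  unfold resV barIdx
  simp only [Equiv.coe_fn_mk, ne_eq, neg_inj]
  split_ifs <;> simp [map_ofNat]

lemma NormalForm.conj_im₂ {α s₀ r : ℝ} (S : NormalForm α s₀ r) (i₁ i₂ : Idx) (ξ : ℝ) :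
    conj (S.im₂ i₁ i₂ ξ) = -S.im₂ (barIdx i₁) (barIdx i₂) ξ := by
  simp [NormalForm.im₂, conj_resV, conj_coeff_of_real S.a₂_symbol.symm S.a₂_real]

/-! ### Skew-adjointness -/

/-- Reindexing by `e` shows that the sum is minus its own conjugate. -/
lemma re_tsum_eq_zero_of_conj {β : Type*} (f : β → ℂ) (e : β ≃ β)
    (h : ∀ b, conj (f b) = -f (e b)) : (∑' b, f b).re = 0 := by
  have : conj (∑' b, f b) = -∑' b, f b := by
    rw [Complex.conj_tsum, tsum_congr h, tsum_neg, e.tsum_eq f]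
  have h2 := congrArg Complex.re this
  simp at h2
  linarith

/-- If `(k, b) ↦ (w_k)^* T k b` is summable and skew under an involution, the operator
`∑ b, T · b` is skew at `w`. -/
lemma tsum_re_pairing_eq_zero {β : Type*} (w : ℤ → ℂ) (T : ℤ → β → ℂ)
    (hs : Summable fun q : ℤ × β => conj (w q.1) * T q.1 q.2) (e : ℤ × β ≃ ℤ × β)
    (h : ∀ q : ℤ × β, conj (conj (w q.1) * T q.1 q.2) =
      -(conj (w (e q).1) * T (e q).1 (e q).2)) :
    ∑' k, (conj (w k) * ∑' b, T k b).re = 0 := by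
  have h0 := re_tsum_eq_zero_of_conj (fun q : ℤ × β => conj (w q.1) * T q.1 q.2) e h
  rw [hs.tsum_prod, Complex.re_tsum hs.prod] at h0
  simpa only [tsum_mul_left] using h0

/-! ### Weighted sums over indices -/

/-- The weighted amplitude `⟨j⟩^μ |u_j^σ|`. -/
def wAmp (μ : ℝ) (z : ℤ → ℂ) (i : Idx) : ℝ := jap i.1 ^ μ * ‖amp z i‖

lemma wAmp_nonneg (μ : ℝ) (z : ℤ → ℂ) (i : Idx) : 0 ≤ wAmp μ z i :=
  mul_nonneg (jap_rpow_pos _ _).le (norm_nonneg _)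

lemma wAmp_sum {μ s : ℝ} (hμ : μ + 1 ≤ s) {z : ℤ → ℂ} (hz : MemHs s z) :
    Summable (wAmp μ z) ∧ ∑' i, wAmp μ z i ≤ 2 * embConst * hsNorm s z := by
  obtain ⟨h1, h2⟩ := summable_and_tsum_jap_mul_norm_le hμ hz
  have h3 : Summable fun _ : ℤˣ => (1 : ℝ) := (hasSum_fintype _).summable
  have h4 : ∑' _ : ℤˣ, (1 : ℝ) = 2 := by rw [tsum_fintype]; simp
  have h5 := h1.mul_of_nonneg h3
    (fun k => mul_nonneg (jap_rpow_pos _ _).le (norm_nonneg _)) (fun _ => zero_le_one)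
  have h6 := h1.hasSum.mul h3.hasSum h5
  have e : (fun x : ℤ × ℤˣ => jap x.1 ^ μ * ‖z x.1‖ * 1) = wAmp μ z := by
    funext x; simp [wAmp, norm_amp]
  rw [e, h4] at h6
  exact ⟨h6.summable, by rw [h6.tsum_eq]; linarith⟩

lemma summable_mul_prod {ι κ : Type*} {f : ι → ℝ} {g : κ → ℝ} (hf : Summable f) (hg : Summable g)
    (hf0 : ∀ i, 0 ≤ f i) (hg0 : ∀ i, 0 ≤ g i) :
    HasSum (fun x : ι × κ => f x.1 * g x.2) ((∑' i, f i) * ∑' i, g i) :=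
  hf.hasSum.mul hg.hasSum (hf.mul_of_nonneg hg hf0 hg0)

/-! ### Paradifferential operators with skew symbols -/

lemma Cutoffs.exists_bound (κ : Cutoffs) :
    ∃ A : ℝ, 0 ≤ A ∧ (∀ y ξ, |κ.χ y ξ| ≤ A) ∧ ∀ y w ξ, |κ.χ₂ y w ξ| ≤ A := by
  obtain ⟨A, hA⟩ := κ.χ_bound 0 0
  obtain ⟨A', hA'⟩ := κ.χ₂_bound 0 0 0
  simp only [iteratedDeriv_zero, Nat.cast_zero, neg_zero, sub_zero, Real.rpow_zero,
    mul_one] at hA hA'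
  exact ⟨max A A', ((abs_nonneg _).trans (hA 0 0)).trans (le_max_left _ _),
    fun y ξ => (hA y ξ).trans (le_max_left _ _), fun y w ξ => (hA' y w ξ).trans (le_max_right _ _)⟩

lemma jap_mul_norm_le_tsum {v : ℤ → ℂ} (hv : MemHs 2 v) (j : ℤ) :
    jap j * ‖v j‖ ≤ ∑' k : ℤ, jap k * ‖v k‖ ∧ Summable fun k : ℤ => jap k * ‖v k‖ := by
  have h := (summable_and_tsum_jap_mul_norm_le (μ := 1) (by norm_num) hv).1
  simp only [Real.rpow_one] at h
  exact ⟨h.le_tsum j fun k _ => mul_nonneg (jap_pos _).le (norm_nonneg _), h⟩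

/-- The `k`-th Fourier coefficient of `Op(a) v`, for a first order symbol with bounded Fourier
coefficients, grows at most like `⟨k⟩`. -/
lemma norm_opNonhom_le {κ : Cutoffs} {X A : ℝ} (hX : 0 ≤ X) (hχ : ∀ y ξ, |κ.χ y ξ| ≤ X)
    {a : ℝ → ℝ → ℂ} (ha : ∀ ξ n, ‖fourierC (fun x => a x ξ) n‖ ≤ A * jap ξ)
    {v : ℤ → ℂ} (k j : ℤ) :
    ‖(κ.χ ((k : ℝ) - j) (((k : ℝ) + j) / 2) : ℂ) *
      fourierC (fun x => a x (((k : ℝ) + j) / 2)) (k - j) * v j‖ ≤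
      X * A * jap k * (jap j * ‖v j‖) := by
  rw [norm_mul, norm_mul, Complex.norm_real, Real.norm_eq_abs]
  have hA : 0 ≤ A :=
    nonneg_of_mul_nonneg_left ((norm_nonneg _).trans (ha 0 0)) (jap_pos 0)
  have h1 := hχ ((k : ℝ) - j) (((k : ℝ) + j) / 2)
  have h2 : ‖fourierC (fun x => a x (((k : ℝ) + j) / 2)) (k - j)‖ ≤ A * (jap k * jap j) :=
    (ha _ _).trans (mul_le_mul_of_nonneg_left (jap_half_add_le _ _) hA)
  calc _ ≤ X * (A * (jap k * jap j)) * ‖v j‖ := by gcongr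
    _ = _ := by ring

lemma opNonhom_bound {κ : Cutoffs} {X A : ℝ} (hX : 0 ≤ X) (hχ : ∀ y ξ, |κ.χ y ξ| ≤ X)
    {a : ℝ → ℝ → ℂ} (ha : ∀ ξ n, ‖fourierC (fun x => a x ξ) n‖ ≤ A * jap ξ)
    {v : ℤ → ℂ} (hv : MemHs 2 v) (k : ℤ) :
    ‖opNonhom κ a v k‖ ≤ X * A * (∑' j : ℤ, jap j * ‖v j‖) * jap k := by
  have h := (jap_mul_norm_le_tsum hv 0).2.hasSum.mul_left (X * A * jap k)
  refine (tsum_of_norm_bounded h fun j => norm_opNonhom_le hX hχ ha k j).trans (le_of_eq ?_)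
  ring

lemma conj_fourierC {f : ℝ → ℂ} (hf : ∀ x, conj (f x) = -f x) (n : ℤ) :
    conj (fourierC f n) = -fourierC f (-n) := by
  unfold fourierC
  rw [map_mul, Complex.conj_ofReal, ← mul_neg, ← intervalIntegral.integral_neg,
    ← intervalIntegral.intervalIntegral_conj]
  congr 2
  funext x
  rw [map_mul, hf, ← Complex.exp_conj, neg_mul]
  congr 3
  simp

/-- Exchanging `k` and `j` fixes the midpoint and reverses `k - j`. The cut-off is even in `k - j`,
and an imaginary symbol satisfies `conj â(n) = -â(-n)`. The `H²` regularity makes the double sum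
absolutely convergent despite the order one. -/
lemma opNonhom_skew {κ : Cutoffs} {A : ℝ} {a : ℝ → ℝ → ℂ}
    (ha : ∀ ξ n, ‖fourierC (fun x => a x ξ) n‖ ≤ A * jap ξ) (hr : ∀ x ξ, conj (a x ξ) = -a x ξ)
    {v : ℤ → ℂ} (hv : MemHs 2 v) :
    ∑' k, (conj (v k) * opNonhom κ a v k).re = 0 := by
  obtain ⟨X, hX, hχ, -⟩ := κ.exists_bound
  have hs := (jap_mul_norm_le_tsum hv 0).2
  have h0 : ∀ k : ℤ, 0 ≤ jap k * ‖v k‖ := fun k => mul_nonneg (jap_pos _).le (norm_nonneg _)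
  refine tsum_re_pairing_eq_zero v (fun k j : ℤ =>
    (κ.χ ((k : ℝ) - j) (((k : ℝ) + j) / 2) : ℂ) *
      fourierC (fun x => a x (((k : ℝ) + j) / 2)) (k - j) * v j) ?_ (Equiv.prodComm ℤ ℤ) ?_
  · refine Summable.of_norm_bounded
      ((summable_mul_prod hs hs h0 h0).summable.mul_left (X * A)) fun q => ?_
    rw [norm_mul, RCLike.norm_conj]
    calc _ ≤ ‖v q.1‖ * (X * A * jap q.1 * (jap q.2 * ‖v q.2‖)) := by
          gcongr; exact norm_opNonhom_le hX hχ ha _ _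
      _ = _ := by ring
  · rintro ⟨k, j⟩
    simp only [map_mul, Complex.conj_conj, Complex.conj_ofReal, Equiv.prodComm_apply,
      Prod.fst_swap, Prod.snd_swap]
    rw [conj_fourierC fun x => hr x _, neg_sub, add_comm (j : ℝ), ← κ.χ_even_left, neg_sub]
    ring

lemma norm_opHom_term_le {κ : Cutoffs} {X A μ : ℝ} (hX : 0 ≤ X) (hA : 0 ≤ A)
    (hχ : ∀ y w ξ, |κ.χ₂ y w ξ| ≤ X) {c : Idx → Idx → ℝ → ℂ}
    (hc : ∀ i₁ i₂ ξ, ‖c i₁ i₂ ξ‖ ≤ A * jap ξ * (jap i₁.1 ^ μ * jap i₂.1 ^ μ))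
    {z v : ℤ → ℂ} (hv : MemHs 2 v) (k j : ℤ) (i : Idx × Idx) :
    ‖(κ.χ₂ i.1.1 i.2.1 (((j : ℝ) + k) / 2) : ℂ) * c i.1 i.2 (((j : ℝ) + k) / 2) *
      amp z i.1 * amp z i.2 * v j‖ ≤
      X * A * (∑' j : ℤ, jap j * ‖v j‖) * jap k * (wAmp μ z i.1 * wAmp μ z i.2) := by
  simp only [norm_mul, Complex.norm_real, Real.norm_eq_abs]
  have hj := (jap_mul_norm_le_tsum hv j).1
  have h1 := hχ i.1.1 i.2.1 (((j : ℝ) + k) / 2)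
  have hp : 0 < jap (i.1.1 : ℝ) ^ μ * jap (i.2.1 : ℝ) ^ μ :=
    mul_pos (jap_rpow_pos _ _) (jap_rpow_pos _ _)
  have h2 := (hc i.1 i.2 (((j : ℝ) + k) / 2)).trans (mul_le_mul_of_nonneg_right
    (mul_le_mul_of_nonneg_left (jap_half_add_le j k) hA) hp.le)
  have hk := (jap_pos k).le
  calc _ ≤ X * (A * (jap j * jap k) * (jap (i.1.1 : ℝ) ^ μ * jap (i.2.1 : ℝ) ^ μ)) *
        ‖amp z i.1‖ * ‖amp z i.2‖ * ‖v j‖ := by gcongr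
    _ = X * A * (jap j * ‖v j‖) * jap k * (wAmp μ z i.1 * wAmp μ z i.2) := by
        unfold wAmp; ring
    _ ≤ _ := by
        have := wAmp_nonneg μ z i.1
        have := wAmp_nonneg μ z i.2
        gcongr

lemma opHom_bound {κ : Cutoffs} {X A μ s₀ : ℝ} (hX : 0 ≤ X) (hA : 0 ≤ A)
    (hχ : ∀ y w ξ, |κ.χ₂ y w ξ| ≤ X) {c : Idx → Idx → ℝ → ℂ}
    (hc : ∀ i₁ i₂ ξ, ‖c i₁ i₂ ξ‖ ≤ A * jap ξ * (jap i₁.1 ^ μ * jap i₂.1 ^ μ))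
    (hμ : μ + 1 ≤ s₀) {z v : ℤ → ℂ} (hz : MemHs s₀ z) (hv : MemHs 2 v) (k : ℤ) :
    ‖opHom κ c z v k‖ ≤
      X * A * (∑' j : ℤ, jap j * ‖v j‖) * ((∑' i, wAmp μ z i) * ∑' i, wAmp μ z i) * jap k := by
  have hw := (wAmp_sum hμ hz).1
  have h := (summable_mul_prod hw hw (wAmp_nonneg μ z) (wAmp_nonneg μ z)).mul_left
    (X * A * (∑' j : ℤ, jap j * ‖v j‖) * jap k)
  refine (tsum_of_norm_bounded h fun i => ?_).trans (le_of_eq (by ring))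
  exact norm_opHom_term_le hX hA hχ hc hv k _ i

/-- `(k, i₁, i₂) ↦ (k - m₁ - m₂, ī₁, ī₂)`, with `m₁`, `m₂` the momenta. -/
def transposeIdx : ℤ × Idx × Idx ≃ ℤ × Idx × Idx where
  toFun q := (q.1 - mom q.2.1 - mom q.2.2, barIdx q.2.1, barIdx q.2.2)
  invFun q := (q.1 - mom q.2.1 - mom q.2.2, barIdx q.2.1, barIdx q.2.2)
  left_inv q := by
    obtain ⟨k, i, j⟩ := q
    simp only [mom_barIdx, Prod.mk.injEq]
    exact ⟨by ring, barIdx.left_inv i, barIdx.left_inv j⟩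
  right_inv q := by
    obtain ⟨k, i, j⟩ := q
    simp only [mom_barIdx, Prod.mk.injEq]
    exact ⟨by ring, barIdx.left_inv i, barIdx.left_inv j⟩

/-- The transposition exchanges input and output frequency and conjugates both amplitudes. It fixes
the midpoint and `j₁, j₂`, hence the cut-off, while the coefficient changes as in `hr`. -/
lemma opHom_skew {κ : Cutoffs} {A μ s₀ : ℝ} (hA : 0 ≤ A) {c : Idx → Idx → ℝ → ℂ}
    (hc : ∀ i₁ i₂ ξ, ‖c i₁ i₂ ξ‖ ≤ A * jap ξ * (jap i₁.1 ^ μ * jap i₂.1 ^ μ))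
    (hr : ∀ i₁ i₂ ξ, conj (c i₁ i₂ ξ) = -c (barIdx i₁) (barIdx i₂) ξ)
    (hμ : μ + 1 ≤ s₀) {z v : ℤ → ℂ} (hz : MemHs s₀ z) (hv : MemHs 2 v) :
    ∑' k, (conj (v k) * opHom κ c z v k).re = 0 := by
  obtain ⟨X, hX, -, hχ⟩ := κ.exists_bound
  have hs := (jap_mul_norm_le_tsum hv 0).2
  have hw := (wAmp_sum hμ hz).1
  have hw2 := (summable_mul_prod hw hw (wAmp_nonneg μ z) (wAmp_nonneg μ z)).summable
  refine tsum_re_pairing_eq_zero v (fun (k : ℤ) (i : Idx × Idx) =>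
    let j : ℤ := k - mom i.1 - mom i.2
    let ξ : ℝ := ((j : ℝ) + k) / 2
    (κ.χ₂ i.1.1 i.2.1 ξ : ℂ) * c i.1 i.2 ξ * amp z i.1 * amp z i.2 * v j) ?_ transposeIdx ?_
  · refine Summable.of_norm_bounded
      ((summable_mul_prod hs hw2 (fun k => mul_nonneg (jap_pos _).le (norm_nonneg _))
        (fun i => mul_nonneg (wAmp_nonneg μ z _) (wAmp_nonneg μ z _))).summable.mul_left
        (X * A * (∑' j : ℤ, jap j * ‖v j‖))) fun q => ?_
    rw [norm_mul, RCLike.norm_conj]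
    refine (mul_le_mul_of_nonneg_left
      (norm_opHom_term_le hX hA hχ hc hv q.1 _ q.2) (norm_nonneg (v q.1))).trans (le_of_eq ?_)
    ring
  · rintro ⟨k, i₁, i₂⟩
    have e : k - mom i₁ - mom i₂ - -mom i₁ - -mom i₂ = k := by ring
    simp only [map_mul, Complex.conj_conj, Complex.conj_ofReal, transposeIdx, Equiv.coe_fn_mk,
      conj_amp, hr, mom_barIdx, e]
    rw [add_comm (k : ℝ)]
    have e1 : ∀ i, (barIdx i).1 = i.1 := fun _ => rfl
    rw [e1, e1]
    ring

/-! ### Fourier coefficients of bounded symbols -/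

lemma WBound.norm_fourierC_le {f : ℝ → ℂ} {M : ℝ} (h : WBound 0 f M) (n : ℤ) :
    ‖fourierC f n‖ ≤ M := by
  obtain ⟨-, -, g, b, hg, hb⟩ := h
  -- The zeroth weak derivative is a function with the same Fourier coefficients as `f`, and it is
  -- the one that carries the almost everywhere bound.
  obtain ⟨-, h2, h3⟩ := hg 0 le_rfl
  have e := h3 n
  rw [pow_zero, one_mul] at e
  rw [← e]
  simp only [zero_add, Finset.range_one, Finset.sum_singleton] at hb
  refine le_trans ?_ hb
  have hpi : 0 < 2 * Real.pi := by positivity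
  have h4 : ‖∫ x in (0 : ℝ)..(2 * Real.pi), g 0 x * Complex.exp (-(Complex.I * n * x))‖ ≤
      b 0 * |2 * Real.pi - 0| := by
    refine intervalIntegral.norm_integral_le_of_norm_le_const_ae ?_
    rw [Set.uIoc_of_le hpi.le]
    filter_upwards [(ae_restrict_iff' measurableSet_Ioc).1 h2] with x hx hx'
    have : ‖Complex.exp (-(Complex.I * n * x))‖ = 1 := by
      rw [Complex.norm_exp]; simp
    rw [norm_mul, this, mul_one]
    exact hx hx'
  unfold fourierC
  rw [norm_mul, Complex.norm_real, Real.norm_of_nonneg (by positivity)]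
  rw [sub_zero, abs_of_pos hpi] at h4
  calc _ ≤ 1 / (2 * Real.pi) * (b 0 * (2 * Real.pi)) := by gcongr
    _ = b 0 := by field_simp

lemma fourierC_add {f g : ℝ → ℂ} (hf : Continuous f) (hg : Continuous g) (n : ℤ) :
    fourierC (fun x => f x + g x) n = fourierC f n + fourierC g n := by
  unfold fourierC
  rw [← mul_add, ← intervalIntegral.integral_add
    (Continuous.intervalIntegrable (by fun_prop) _ _)
    (Continuous.intervalIntegrable (by fun_prop) _ _)]
  simp_rw [add_mul]

lemma fourierC_const_mul (c : ℂ) (f : ℝ → ℂ) (n : ℤ) :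
    fourierC (fun x => c * f x) n = c * fourierC f n := by
  unfold fourierC
  simp_rw [mul_assoc c, intervalIntegral.integral_const_mul]
  ring

/-- The smallness in `z` is discarded: these symbols drop out of the energy by skewness, and the
bound serves only for convergence of the pairings. -/
lemma IsNonhomSymbol.exists_fourierC_bound {s₀ r m : ℝ} {p : ℕ} {a : (ℤ → ℂ) → ℝ → ℝ → ℂ}
    (ha : IsNonhomSymbol s₀ r m p a) :
    ∃ A r₁ : ℝ, 0 ≤ A ∧ 0 < r₁ ∧ ∀ z, MemHs s₀ z → hsNorm s₀ z < r₁ → ∀ ξ : ℝ,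
      (Continuous fun x => a z x ξ) ∧ ∀ n, ‖fourierC (fun x => a z x ξ) n‖ ≤ A * jap ξ ^ m := by
  obtain ⟨r', hr', -, h⟩ := ha.bound s₀ le_rfl
  obtain ⟨C, hC⟩ := h 0
  refine ⟨|C|, min r' 1, abs_nonneg _, lt_min hr' one_pos, fun z hz hzr ξ => ?_⟩
  have hw := hC z hz (hzr.trans_le (min_le_left _ _)) 0 (by simp) ξ
  simp only [iteratedDeriv_zero, Nat.cast_zero, sub_zero] at hw
  refine ⟨hw.1, fun n => (hw.norm_fourierC_le n).trans ?_⟩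
  have h1 : hsNorm s₀ z ≤ 1 := (hzr.trans_le (min_le_right _ _)).le
  have h0 := hsNorm_nonneg s₀ z
  have h2 : hsNorm s₀ z ^ (p - 1) * hsNorm s₀ z ≤ 1 :=
    mul_le_one₀ (pow_le_one₀ h0 h1) h0 h1
  have hj := (jap_rpow_pos ξ m).le
  rw [mul_assoc]
  calc _ ≤ |C| * jap ξ ^ m * (hsNorm s₀ z ^ (p - 1) * hsNorm s₀ z) := by
        gcongr; exact le_abs_self C
    _ ≤ |C| * jap ξ ^ m * 1 := by gcongr
    _ = _ := mul_one _

/-- At regularity `s₀` the two terms of the tame estimate coincide when `v` and `z` have equal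
norms. This covers both `v = z` and `v = conj z`. -/
lemma IsNonhomOp.exists_coeff_bound {s₀ r : ℝ} (hs₀ : 1 ≤ s₀) {B : (ℤ → ℂ) → (ℤ → ℂ) → ℤ → ℂ}
    (hB : IsNonhomOp s₀ r 4 B) :
    ∃ A r₁ : ℝ, 0 ≤ A ∧ 0 < r₁ ∧ ∀ z v, MemHs s₀ z → hsNorm s₀ z < r₁ → MemHs s₀ v →
      hsNorm s₀ v = hsNorm s₀ z → ∀ k : ℤ,
        ‖B z v k‖ ≤ A * hsNorm s₀ z ^ 5 * jap k ^ (-1 : ℝ) := by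
  obtain ⟨C, r', hr', -, h⟩ := hB.bound s₀ le_rfl
  refine ⟨2 * |C|, r', by positivity, hr', fun z v hz hzr hv hvz k => ?_⟩
  obtain ⟨h1, h2⟩ := h z hz hzr v hv
  have h0 := hsNorm_nonneg s₀ z
  have h3 : hsNorm s₀ (B z v) ≤ 2 * |C| * hsNorm s₀ z ^ 5 := by
    refine h2.trans ?_
    rw [hvz]
    calc _ = C * (2 * hsNorm s₀ z ^ 5) := by ring
      _ ≤ |C| * (2 * hsNorm s₀ z ^ 5) := by gcongr; exact le_abs_self C
      _ = _ := by ring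
  have h4 : jap k ^ (-s₀) ≤ jap k ^ (-1 : ℝ) := jap_rpow_mono _ (by linarith)
  have := (jap_rpow_pos k (-s₀)).le
  calc _ ≤ _ := norm_coeff_le h1 k
    _ ≤ _ := by gcongr

/-! ### The cubic terms -/

lemma numOutside_le_four (i₁ i₂ i₃ : Idx) (k : ℤ) : numOutside i₁ i₂ i₃ k ≤ 4 := by
  unfold numOutside; split_ifs <;> norm_num

/-- Momentum conservation gives `⟨k⟩ ≤ 3 m₁`, so one of the four powers of smoothing becomes the
decay `⟨k⟩⁻¹`, enough for an `ℓ²` bound on the output. The factor `m₂^μ` is spread over all three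
inputs. -/
lemma IsHomSmoothing.norm_le {μ : ℝ} (hμ : 0 ≤ μ) {R : Idx → Idx → Idx → ℂ}
    (hR : IsHomSmoothing 4 μ R) : ∃ A : ℝ, 0 ≤ A ∧ ∀ i₁ i₂ i₃ k, InP₄ i₁ i₂ i₃ k →
      ‖R i₁ i₂ i₃‖ ≤ A * jap k ^ (-1 : ℝ) * (jap i₁.1 ^ μ * (jap i₂.1 ^ μ * jap i₃.1 ^ μ)) := by
  obtain ⟨C, hC⟩ := hR.bound
  refine ⟨3 * |C|, by positivity, fun i₁ i₂ i₃ k hk => (hC i₁ i₂ i₃).trans ?_⟩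
  have a1 := one_le_jap i₁.1
  have a2 := one_le_jap i₂.1
  have a3 := one_le_jap i₃.1
  set x := jap i₁.1
  set y := jap i₂.1
  set w := jap i₃.1
  set m := max x (max y w)
  have hm : 1 ≤ m := a1.trans (le_max_left _ _)
  have hxy : 1 ≤ x * y := one_le_mul_of_one_le_of_one_le a1 a2
  have hmax : max₂ x y w ≤ x * (y * w) := by
    have : m ≤ x * (y * w) := max_le (by nlinarith) (max_le (by nlinarith) (by nlinarith))
    refine le_trans ?_ this
    unfold max₂
    exact max_le ((min_le_left _ _).trans (le_max_left _ _))
      (max_le ((min_le_left _ _).trans ((le_max_left _ _).trans (le_max_right _ _)))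
        ((min_le_left _ _).trans (le_max_left _ _)))
  have hmax0 : 0 ≤ max₂ x y w :=
    le_max_of_le_left (le_min (by linarith) (by linarith))
  have h1 : max₂ x y w ^ μ ≤ x ^ μ * (y ^ μ * w ^ μ) := by
    rw [← Real.mul_rpow (by linarith) (by linarith), ← Real.mul_rpow (by linarith) (by positivity)]
    exact Real.rpow_le_rpow hmax0 hmax hμ
  have hmom : ∀ i : Idx, |(mom i : ℝ)| ≤ jap i.1 := fun i => by
    refine le_trans (le_of_eq ?_) (abs_le_jap _)
    rcases Int.units_eq_one_or i.2 with h | h <;> simp [mom, h]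
  have hkm : jap k ≤ 3 * m := by
    refine max_le (by linarith) ?_
    have e : (k : ℝ) = mom i₁ + mom i₂ + mom i₃ := by exact_mod_cast hk.1.symm
    rw [e]
    have b1 := (hmom i₁).trans (le_max_left x (max y w))
    have b2 := (hmom i₂).trans ((le_max_left y w).trans (le_max_right x _))
    have b3 := (hmom i₃).trans ((le_max_right y w).trans (le_max_right x _))
    exact (abs_add_three _ _ _).trans (by linarith)
  have h2 : m ^ (-4 : ℝ) ≤ 3 * jap k ^ (-1 : ℝ) := by
    refine (Real.rpow_le_rpow_of_exponent_le hm (by norm_num : (-4 : ℝ) ≤ -1)).trans ?_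
    rw [Real.rpow_neg_one, Real.rpow_neg_one, ← div_eq_mul_inv,
      inv_le_comm₀ (by linarith) (div_pos three_pos (jap_pos _)), inv_div,
      div_le_iff₀ three_pos]
    linarith
  have h3 : 0 ≤ max₂ x y w ^ μ := Real.rpow_nonneg hmax0 _
  have h4 : 0 ≤ m ^ (-4 : ℝ) := Real.rpow_nonneg (by linarith) _
  calc _ ≤ |C| * (x ^ μ * (y ^ μ * w ^ μ)) * (3 * jap k ^ (-1 : ℝ)) := by
        gcongr; exact le_abs_self C
    _ = _ := by ring

lemma summable_mul_prod₃ {f g h : Idx → ℝ} (hf : Summable f) (hg : Summable g) (hh : Summable h)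
    (hf0 : ∀ i, 0 ≤ f i) (hg0 : ∀ i, 0 ≤ g i) (hh0 : ∀ i, 0 ≤ h i) :
    HasSum (fun x : Idx × Idx × Idx => f x.1 * (g x.2.1 * h x.2.2))
      ((∑' i, f i) * ((∑' i, g i) * ∑' i, h i)) := by
  have h1 := summable_mul_prod hg hh hg0 hh0
  rw [← h1.tsum_eq]
  exact summable_mul_prod hf h1.summable hf0 fun i => mul_nonneg (hg0 _) (hh0 _)

lemma wAmp_perp_of_mem {μ : ℝ} {z : ℤ → ℂ} {i : Idx} (hi : ¬(i.1 = 1 ∨ i.1 = -1)) :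
    wAmp μ (perp z) i = wAmp μ z i := by
  simp [wAmp, norm_amp, perp, hi]

/-- If at least three of `j₁, j₂, j₃, k` lie outside `Λ`, two of `j₁, j₂, j₃` do. -/
lemma wAmp_mul_le_of_three_le {μ : ℝ} (z : ℤ → ℂ) {i₁ i₂ i₃ : Idx} {k : ℤ}
    (h : 3 ≤ numOutside i₁ i₂ i₃ k) :
    wAmp μ z i₁ * (wAmp μ z i₂ * wAmp μ z i₃) ≤
      wAmp μ (perp z) i₁ * (wAmp μ (perp z) i₂ * wAmp μ z i₃) +
      wAmp μ (perp z) i₁ * (wAmp μ z i₂ * wAmp μ (perp z) i₃) +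
      wAmp μ z i₁ * (wAmp μ (perp z) i₂ * wAmp μ (perp z) i₃) := by
  have n1 := wAmp_nonneg μ z i₁
  have n2 := wAmp_nonneg μ z i₂
  have n3 := wAmp_nonneg μ z i₃
  have p1 := wAmp_nonneg μ (perp z) i₁
  have p2 := wAmp_nonneg μ (perp z) i₂
  have p3 := wAmp_nonneg μ (perp z) i₃
  have q1 := mul_nonneg p1 (mul_nonneg p2 n3)
  have q2 := mul_nonneg p1 (mul_nonneg n2 p3)
  have q3 := mul_nonneg n1 (mul_nonneg p2 p3)
  by_cases h1 : i₁.1 = 1 ∨ i₁.1 = -1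
  · by_cases h2 : i₂.1 = 1 ∨ i₂.1 = -1
    · exfalso
      simp only [numOutside, h1, h2, if_true] at h
      split_ifs at h <;> omega
    · by_cases h3 : i₃.1 = 1 ∨ i₃.1 = -1
      · exfalso
        simp only [numOutside, h1, h3, if_true] at h
        split_ifs at h <;> omega
      · rw [wAmp_perp_of_mem h2, wAmp_perp_of_mem h3] at *
        linarith
  · by_cases h2 : i₂.1 = 1 ∨ i₂.1 = -1
    · by_cases h3 : i₃.1 = 1 ∨ i₃.1 = -1
      · exfalso
        simp only [numOutside, h2, h3, if_true] at h
        split_ifs at h <;> omega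
      · rw [wAmp_perp_of_mem h1, wAmp_perp_of_mem h3] at *
        linarith
    · rw [wAmp_perp_of_mem h1, wAmp_perp_of_mem h2] at *
      linarith

/-- The part of the cubic field with at least three indices outside `Λ` is quadratic in the normal
component. -/
lemma exists_cubic_bound {μ s₀ : ℝ} (hμ : 0 ≤ μ) (hμs : μ + 1 ≤ s₀) {R : Idx → Idx → Idx → ℂ}
    (hR : IsHomSmoothing 4 μ R) (h1 : ∀ z, MemHs s₀ z → cubicProj 1 R z = 0)
    (h2 : ∀ z, MemHs s₀ z → cubicProj 2 R z = 0) :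
    ∃ A : ℝ, 0 ≤ A ∧ ∀ z, MemHs s₀ z → ∀ k : ℤ,
      ‖cubic R z k - cubicProj 0 R z k‖ ≤
        A * (hsNorm s₀ (perp z) ^ 2 * hsNorm s₀ z) * jap k ^ (-1 : ℝ) := by
  obtain ⟨A, hA, hRA⟩ := hR.norm_le hμ
  refine ⟨A * (3 * (2 * embConst) ^ 3), mul_nonneg hA
    (mul_nonneg three_pos.le (pow_nonneg (mul_nonneg two_pos.le embConst_nonneg) _)),
    fun z hz k => ?_⟩
  have hzp : MemHs s₀ (perp z) := hz.mono_of_norm_le (norm_perp_le z)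
  obtain ⟨sz, tz⟩ := wAmp_sum hμs hz
  obtain ⟨sp, tp⟩ := wAmp_sum hμs hzp
  have nz := wAmp_nonneg μ z
  have np := wAmp_nonneg μ (perp z)
  have hj := (jap_rpow_pos k (-1)).le
  set T : Idx × Idx × Idx → ℂ := fun i => if InP₄ i.1 i.2.1 i.2.2 k then
      R i.1 i.2.1 i.2.2 * amp z i.1 * amp z i.2.1 * amp z i.2.2 else 0 with hT
  have hTn : ∀ i, ‖T i‖ ≤ A * jap k ^ (-1 : ℝ) *
      (wAmp μ z i.1 * (wAmp μ z i.2.1 * wAmp μ z i.2.2)) := fun i => by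
    rw [hT]
    dsimp only
    split_ifs with hi
    · simp only [norm_mul]
      have := hRA _ _ _ _ hi
      calc _ ≤ A * jap k ^ (-1 : ℝ) *
            (jap i.1.1 ^ μ * (jap i.2.1.1 ^ μ * jap i.2.2.1 ^ μ)) *
            ‖amp z i.1‖ * ‖amp z i.2.1‖ * ‖amp z i.2.2‖ := by gcongr
        _ = _ := by unfold wAmp; ring
    · rw [norm_zero]
      exact mul_nonneg (mul_nonneg hA hj) (mul_nonneg (nz _) (mul_nonneg (nz _) (nz _)))
  have hTs : Summable T := Summable.of_norm_bounded
    ((summable_mul_prod₃ sz sz sz nz nz nz).summable.mul_left _) hTn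
  let N : Idx × Idx × Idx → ℕ := fun i => numOutside i.1 i.2.1 i.2.2 k
  have hproj : ∀ n, cubicProj n R z k = ∑' i, {i | N i = n}.indicator T i := fun n => by
    refine tsum_congr fun i => ?_
    simp only [Set.indicator, Set.mem_ofPred_eq, hT, N]
    by_cases ha : InP₄ i.1 i.2.1 i.2.2 k <;>
      by_cases hb : numOutside i.1 i.2.1 i.2.2 k = n <;> simp [ha, hb]
  -- The projections with `n = 1, 2` vanish as fields, so subtracting them is free. They are removed
  -- at the level of sums; nothing is claimed about individual coefficients `R`.
  have hsub : cubic R z k - cubicProj 0 R z k = ∑' i, {i | 3 ≤ N i}.indicator T i := by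
    have e0 : cubic R z k - cubicProj 0 R z k =
        cubic R z k - cubicProj 0 R z k - cubicProj 1 R z k - cubicProj 2 R z k := by
      rw [h1 z hz, h2 z hz]; simp
    have e1 : cubic R z k = ∑' i, T i := rfl
    rw [e0, e1, hproj, hproj, hproj, ← hTs.tsum_sub (hTs.indicator _),
      ← (hTs.sub (hTs.indicator _)).tsum_sub (hTs.indicator _),
      ← ((hTs.sub (hTs.indicator _)).sub (hTs.indicator _)).tsum_sub (hTs.indicator _)]
    refine tsum_congr fun i => ?_
    have hN : N i ≤ 4 := numOutside_le_four _ _ _ _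
    have hN' : N i = 0 ∨ N i = 1 ∨ N i = 2 ∨ N i = 3 ∨ N i = 4 := by omega
    rcases hN' with h | h | h | h | h <;> simp [Set.indicator, h]
  rw [hsub]
  have hb := ((summable_mul_prod₃ sp sp sz np np nz).add
    (summable_mul_prod₃ sp sz sp np nz np)).add (summable_mul_prod₃ sz sp sp nz np np)
  refine (tsum_of_norm_bounded (hb.mul_left (A * jap k ^ (-1 : ℝ))) fun i => ?_).trans ?_
  · by_cases hi : 3 ≤ N i
    · rw [Set.indicator_of_mem (by exact hi)]
      exact (hTn i).trans (mul_le_mul_of_nonneg_left (wAmp_mul_le_of_three_le z hi)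
        (mul_nonneg hA hj))
    · rw [Set.indicator_of_notMem (by exact hi), norm_zero]
      exact mul_nonneg (mul_nonneg hA hj) (add_nonneg (add_nonneg
        (mul_nonneg (np _) (mul_nonneg (np _) (nz _)))
        (mul_nonneg (np _) (mul_nonneg (nz _) (np _))))
        (mul_nonneg (nz _) (mul_nonneg (np _) (np _))))
  · have tz0 : 0 ≤ ∑' i, wAmp μ z i := tsum_nonneg nz
    have tp0 : 0 ≤ ∑' i, wAmp μ (perp z) i := tsum_nonneg np
    have : (∑' i, wAmp μ (perp z) i) * ((∑' i, wAmp μ (perp z) i) * ∑' i, wAmp μ z i) ≤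
        (2 * embConst * hsNorm s₀ (perp z)) *
          ((2 * embConst * hsNorm s₀ (perp z)) * (2 * embConst * hsNorm s₀ z)) := by
      have := tp0.trans tp
      gcongr
    calc _ = A * jap k ^ (-1 : ℝ) * (3 * ((∑' i, wAmp μ (perp z) i) *
          ((∑' i, wAmp μ (perp z) i) * ∑' i, wAmp μ z i))) := by ring
      _ ≤ A * jap k ^ (-1 : ℝ) * (3 * ((2 * embConst * hsNorm s₀ (perp z)) *
          ((2 * embConst * hsNorm s₀ (perp z)) * (2 * embConst * hsNorm s₀ z)))) := by gcongr
      _ = _ := by ring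

/-! ### The symbols of the normal form -/

namespace NormalForm

variable {α s₀ r : ℝ} (S : NormalForm α s₀ r)

lemma one_le_s₀ {α s₀ r : ℝ} (S : NormalForm α s₀ r) : 1 ≤ s₀ := by linarith [S.μa_nonneg, S.μa_le]

lemma exists_im₂_bound (hα : α ≤ 1) : ∃ A : ℝ, 0 ≤ A ∧ ∀ i₁ i₂ ξ,
    ‖S.im₂ i₁ i₂ ξ‖ ≤ A * jap ξ * (jap i₁.1 ^ S.μa * jap i₂.1 ^ S.μa) := by
  obtain ⟨C, hC⟩ := S.a₂_symbol.bound 0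
  refine ⟨1 + |C|, by positivity, fun i₁ i₂ ξ => ?_⟩
  have hμ := S.μa_nonneg
  have x1 : 1 ≤ jap i₁.1 ^ S.μa := Real.one_le_rpow (one_le_jap _) hμ
  have x2 : 1 ≤ jap i₂.1 ^ S.μa := Real.one_le_rpow (one_le_jap _) hμ
  have hj := one_le_jap ξ
  have hV : ‖resV i₁ i₂ ξ‖ ≤ jap ξ := by
    unfold resV
    split_ifs
    · rw [norm_div, Complex.norm_real, Real.norm_eq_abs, Complex.norm_ofNat]
      linarith [abs_le_jap ξ, abs_nonneg ξ]
    · rw [norm_zero]; linarith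
  have ha := hC i₁ i₂ ξ
  simp only [iteratedDeriv_zero, Nat.cast_zero, sub_zero] at ha
  have hmax : max |(i₁.1 : ℝ)| |(i₂.1 : ℝ)| ≤ jap i₁.1 * jap i₂.1 :=
    max_le (by nlinarith [abs_le_jap i₁.1, one_le_jap i₂.1, jap_pos i₁.1])
      (by nlinarith [abs_le_jap i₂.1, one_le_jap i₁.1, jap_pos i₂.1])
  have hmax' : max |(i₁.1 : ℝ)| |(i₂.1 : ℝ)| ^ S.μa ≤ jap i₁.1 ^ S.μa * jap i₂.1 ^ S.μa := by
    rw [← Real.mul_rpow (jap_pos _).le (jap_pos _).le]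
    exact Real.rpow_le_rpow (le_max_of_le_left (abs_nonneg _)) hmax hμ
  have hjα : jap ξ ^ α ≤ jap ξ := by
    simpa using jap_rpow_mono ξ hα
  have hm0 : 0 ≤ max |(i₁.1 : ℝ)| |(i₂.1 : ℝ)| ^ S.μa :=
    Real.rpow_nonneg (le_max_of_le_left (abs_nonneg _)) _
  have hj0 := (jap_rpow_pos ξ α).le
  have h12 : 1 ≤ jap i₁.1 ^ S.μa * jap i₂.1 ^ S.μa := one_le_mul_of_one_le_of_one_le x1 x2
  unfold NormalForm.im₂
  rw [norm_mul, Complex.norm_I, one_mul]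
  calc _ ≤ ‖resV i₁ i₂ ξ‖ + ‖S.a₂ i₁ i₂ ξ‖ := norm_add_le _ _
    _ ≤ jap ξ + |C| * (jap i₁.1 ^ S.μa * jap i₂.1 ^ S.μa) * jap ξ := by
        refine add_le_add hV (ha.trans ?_)
        gcongr
        exact le_abs_self C
    _ ≤ jap ξ * (jap i₁.1 ^ S.μa * jap i₂.1 ^ S.μa) +
        |C| * (jap i₁.1 ^ S.μa * jap i₂.1 ^ S.μa) * jap ξ := by
        have := le_mul_of_one_le_right (jap_pos ξ).le h12
        linarith
    _ = _ := by ring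

lemma exists_im₄_bound (hα : α ≤ 1) : ∃ A r₁ : ℝ, 0 ≤ A ∧ 0 < r₁ ∧
    ∀ z, MemHs s₀ z → hsNorm s₀ z < r₁ → ∀ ξ n,
      ‖fourierC (fun x => S.im₄ z x ξ) n‖ ≤ A * jap ξ := by
  obtain ⟨A, r₁, hA, hr₁, h⟩ := S.V₄_symbol.exists_fourierC_bound
  obtain ⟨A', r₁', hA', hr₁', h'⟩ := S.a₄_symbol.exists_fourierC_bound
  refine ⟨A + A', min r₁ r₁', by positivity, lt_min hr₁ hr₁', fun z hz hzr ξ n => ?_⟩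
  obtain ⟨c1, b1⟩ := h z hz (hzr.trans_le (min_le_left _ _)) ξ
  obtain ⟨c2, b2⟩ := h' z hz (hzr.trans_le (min_le_right _ _)) ξ
  have e : (fun x => S.im₄ z x ξ) = fun x => Complex.I * ((ξ : ℂ) * S.V₄ z x + S.a₄ z x ξ) := by
    funext x; unfold NormalForm.im₄; ring
  rw [e, fourierC_const_mul, fourierC_add (f := fun x => (ξ : ℂ) * S.V₄ z x) (continuous_const.mul c1) c2, fourierC_const_mul,
    norm_mul, Complex.norm_I, one_mul]
  have b1' := b1 n
  rw [Real.rpow_zero, mul_one] at b1'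
  have hjα : jap ξ ^ α ≤ jap ξ := by simpa using jap_rpow_mono ξ hα
  calc _ ≤ ‖(ξ : ℂ) * fourierC (fun x => S.V₄ z x) n‖ + ‖fourierC (fun x => S.a₄ z x ξ) n‖ :=
        norm_add_le _ _
    _ ≤ jap ξ * A + A' * jap ξ := by
        refine add_le_add ?_ ((b2 n).trans (by gcongr))
        rw [norm_mul, Complex.norm_real, Real.norm_eq_abs]
        exact mul_le_mul (abs_le_jap ξ) b1' (norm_nonneg _) (jap_pos ξ).le
    _ = _ := by ring

lemma conj_im₄ {z : ℤ → ℂ} (hz : MemHs s₀ z) (hzr : hsNorm s₀ z < r) (x ξ : ℝ) :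
    conj (S.im₄ z x ξ) = -S.im₄ z x ξ := by
  have h1 := Complex.conj_eq_iff_im.2 (S.V₄_real z hz hzr x)
  have h2 := Complex.conj_eq_iff_im.2 (S.a₄_real z hz hzr x ξ)
  simp [NormalForm.im₄, h1, h2]

lemma exists_bZ_bound : ∃ A r₁ : ℝ, 0 ≤ A ∧ 0 < r₁ ∧
    ∀ z, MemHs s₀ z → hsNorm s₀ z < r₁ → ∀ k : ℤ,
      ‖S.bZ z k‖ ≤ A * hsNorm s₀ z ^ 5 * jap k ^ (-1 : ℝ) := by
  obtain ⟨A, r₁, hA, hr₁, h⟩ := S.B₁_op.exists_coeff_bound S.one_le_s₀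
  obtain ⟨A', r₁', hA', hr₁', h'⟩ := S.B₂_op.exists_coeff_bound S.one_le_s₀
  refine ⟨A + A', min r₁ r₁', by positivity, lt_min hr₁ hr₁', fun z hz hzr k => ?_⟩
  have b1 := h z z hz (hzr.trans_le (min_le_left _ _)) hz rfl k
  have b2 := h' z _ hz (hzr.trans_le (min_le_right _ _)) hz.conjFun (hsNorm_conjFun s₀ z) k
  calc _ ≤ ‖S.B₁ z z k‖ + ‖S.B₂ z (conjFun z) k‖ := norm_add_le _ _
    _ ≤ _ := add_le_add b1 b2
    _ = _ := by ring

end NormalForm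

/-! ### The real `L²` pairing -/

/-- `Re ⟨w, F⟩`. -/
def pair (w F : ℤ → ℂ) : ℝ := ∑' k, (conj (w k) * F k).re

lemma norm_pair_term_le {w F : ℤ → ℂ} {L : ℝ} (hF : ∀ k : ℤ, ‖F k‖ ≤ L * jap k) (k : ℤ) :
    ‖(conj (w k) * F k).re‖ ≤ L * (jap k * ‖w k‖) := by
  calc _ ≤ ‖conj (w k) * F k‖ := Complex.abs_re_le_norm _
    _ = ‖w k‖ * ‖F k‖ := by rw [norm_mul, RCLike.norm_conj]
    _ ≤ ‖w k‖ * (L * jap k) := by gcongr; exact hF k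
    _ = _ := by ring

lemma summable_pair {w F : ℤ → ℂ} (hw : MemHs 2 w) {L : ℝ} (hF : ∀ k : ℤ, ‖F k‖ ≤ L * jap k) :
    Summable fun k => (conj (w k) * F k).re :=
  Summable.of_norm_bounded ((jap_mul_norm_le_tsum hw 0).2.mul_left L) (norm_pair_term_le hF)

/-- The growth bounds make both pairings absolutely convergent, so that the cancelling terms may be
separated. -/
lemma pair_add {w F G : ℤ → ℂ} (hw : MemHs 2 w) {L L' : ℝ} (hF : ∀ k : ℤ, ‖F k‖ ≤ L * jap k)
    (hG : ∀ k : ℤ, ‖G k‖ ≤ L' * jap k) : pair w (F + G) = pair w F + pair w G := by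
  unfold pair
  rw [← (summable_pair hw hF).tsum_add (summable_pair hw hG)]
  simp [mul_add]

/-- Decay `⟨k⟩⁻¹` puts `G` in `ℓ²`, so only the `L²` norm of `w` is paid. -/
lemma pair_le {w G : ℤ → ℂ} (hw : MemHs 0 w) {D : ℝ}
    (hG : ∀ k : ℤ, ‖G k‖ ≤ D * jap k ^ (-1 : ℝ)) : pair w G ≤ D * (embConst * hsNorm 0 w) := by
  obtain ⟨h1, h2⟩ := summable_and_tsum_jap_mul_norm_le (μ := -1) (by norm_num) hw
  have hD : 0 ≤ D := nonneg_of_mul_nonneg_left ((norm_nonneg _).trans (hG 0)) (jap_rpow_pos _ _)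
  have h3 : ∀ k : ℤ, ‖(conj (w k) * G k).re‖ ≤ D * (jap k ^ (-1 : ℝ) * ‖w k‖) := fun k => by
    calc _ ≤ ‖conj (w k) * G k‖ := Complex.abs_re_le_norm _
      _ = ‖w k‖ * ‖G k‖ := by rw [norm_mul, RCLike.norm_conj]
      _ ≤ ‖w k‖ * (D * jap k ^ (-1 : ℝ)) := by gcongr; exact hG k
      _ = _ := by ring
  refine (le_abs_self _).trans ((tsum_of_norm_bounded (h1.hasSum.mul_left D) h3).trans ?_)
  gcongr

/-! ### Energy estimate and continuity argument -/

lemma rpow_neg_three_mul (k : ℤ) : jap k ^ (-3 : ℝ) * jap k = jap k ^ (-2 : ℝ) := by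
  conv_lhs => rw [← Real.rpow_one (jap k), ← Real.rpow_mul (jap_pos _).le]
  rw [← Real.rpow_add (jap_pos _)]
  norm_num

lemma norm_sq_le_of_decay {M : ℝ} {a : ℂ} {k : ℤ} (h : ‖a‖ ≤ M * jap k ^ (-3 : ℝ)) :
    ‖a‖ ^ 2 ≤ M ^ 2 * jap k ^ (-2 : ℝ) := by
  calc ‖a‖ ^ 2 ≤ (M * jap k ^ (-3 : ℝ)) ^ 2 := by gcongr
    _ = M ^ 2 * jap k ^ (-6 : ℝ) := by
        rw [mul_pow, ← Real.rpow_natCast (jap k ^ (-3 : ℝ)), ← Real.rpow_mul (jap_pos _).le]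
        norm_num
    _ ≤ _ := by gcongr; exacts [one_le_jap _, by norm_num]

lemma continuousOn_tsum_norm_sq {w : ℝ → ℤ → ℂ} {T M : ℝ}
    (hc : ∀ k, ContinuousOn (fun τ => w τ k) (Set.Icc 0 T))
    (hM : ∀ τ ∈ Set.Icc 0 T, ∀ k : ℤ, ‖w τ k‖ ≤ M * jap k ^ (-3 : ℝ)) :
    ContinuousOn (fun τ => ∑' k, ‖w τ k‖ ^ 2) (Set.Icc 0 T) :=
  continuousOn_tsum (fun k => (hc k).norm.pow 2) (summable_jap_neg_two.mul_left (M ^ 2))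
    fun k τ hτ => by
      rw [Real.norm_of_nonneg (by positivity)]
      exact norm_sq_le_of_decay (hM τ hτ k)

/-- The decay `⟨k⟩⁻³` of `w` against the growth `⟨k⟩` of `F` leaves the summable majorant `⟨k⟩⁻²`,
which permits termwise differentiation. `M` and `L` affect only this justification; the final bound
involves `D` alone. -/
lemma tsum_norm_sq_le_of_pair_le {w F : ℝ → ℤ → ℂ} {t M L D : ℝ} (ht : 0 ≤ t)
    (hd : ∀ τ ∈ Set.Icc 0 t, ∀ k,
      HasDerivWithinAt (fun τ => w τ k) (F τ k) (Set.Icc 0 t) τ)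
    (hM : ∀ τ ∈ Set.Icc 0 t, ∀ k : ℤ, ‖w τ k‖ ≤ M * jap k ^ (-3 : ℝ))
    (hF : ∀ τ ∈ Set.Icc 0 t, ∀ k : ℤ, ‖F τ k‖ ≤ L * jap k)
    (hD : ∀ τ ∈ Set.Icc 0 t, pair (w τ) (F τ) ≤ D) :
    ∑' k, ‖w t k‖ ^ 2 ≤ ∑' k, ‖w 0 k‖ ^ 2 + 2 * D * t := by
  have hderiv : ∀ τ ∈ Set.Ioo 0 t,
      HasDerivAt (fun τ => ∑' k, ‖w τ k‖ ^ 2) (2 * pair (w τ) (F τ)) τ := by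
    intro τ hτ
    unfold pair
    rw [← tsum_mul_left]
    refine hasDerivAt_tsum_of_isPreconnected
      (g := fun (k : ℤ) (τ : ℝ) => ‖w τ k‖ ^ 2)
      (g' := fun (k : ℤ) (τ : ℝ) => 2 * (conj (w τ k) * F τ k).re)
      (summable_jap_neg_two.mul_left (2 * (M * L))) isOpen_Ioo
      isPreconnected_Ioo (fun k y hy => ?_) (fun k y hy => ?_) hτ ?_ hτ
    · have h := ((hd y (Set.Ioo_subset_Icc_self hy) k).hasDerivAt (Icc_mem_nhds hy.1 hy.2)).norm_sq
      rwa [Complex.inner, mul_comm (F y k)] at h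
    · have hy' := Set.Ioo_subset_Icc_self hy
      have h1 := hM y hy' k
      have h2 := hF y hy' k
      have h3 := (norm_nonneg _).trans h1
      rw [norm_mul, Real.norm_ofNat]
      calc _ ≤ 2 * ‖conj (w y k) * F y k‖ := by gcongr; exact Complex.abs_re_le_norm _
        _ = 2 * (‖w y k‖ * ‖F y k‖) := by rw [norm_mul, RCLike.norm_conj]
        _ ≤ 2 * ((M * jap k ^ (-3 : ℝ)) * (L * jap k)) := by gcongr
        _ = 2 * (M * L) * (jap k ^ (-3 : ℝ) * jap k) := by ring
        _ = _ := by rw [rpow_neg_three_mul]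
    · exact Summable.of_nonneg_of_le (fun k => by positivity)
        (fun k => norm_sq_le_of_decay (hM τ (Set.Ioo_subset_Icc_self hτ) k))
        (summable_jap_neg_two.mul_left (M ^ 2))
  have hcont := continuousOn_tsum_norm_sq
    (fun k τ hτ => (hd τ hτ k).continuousWithinAt) hM
  have h := (convex_Icc 0 t).image_sub_le_mul_sub_of_deriv_le (C := 2 * D) hcont
    (by
      rw [interior_Icc]
      exact fun τ hτ => (hderiv τ hτ).differentiableAt.differentiableWithinAt)
    (by
      rw [interior_Icc]
      intro τ hτ
      rw [(hderiv τ hτ).deriv]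
      linarith [hD τ (Set.Ioo_subset_Icc_self hτ)])
    0 (Set.left_mem_Icc.2 ht) t (Set.right_mem_Icc.2 ht) ht
  linarith

/-- Otherwise there is a first time with `g ≥ 0`. There `g = 0` by the intermediate value theorem
and `g < 0` before, so the hypothesis applies and contradicts `g = 0`. -/
lemma continuous_bootstrap {g : ℝ → ℝ} {T : ℝ} (hg : ContinuousOn g (Set.Icc 0 T)) (h0 : g 0 < 0)
    (h : ∀ t ∈ Set.Icc 0 T, (∀ τ ∈ Set.Icc 0 t, g τ ≤ 0) → g t < 0) :
    ∀ t ∈ Set.Icc 0 T, g t ≤ 0 := by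
  intro t ht
  by_contra! hgt
  have hK : IsCompact (Set.Icc 0 T ∩ g ⁻¹' Set.Ici 0) :=
    isCompact_Icc.of_isClosed_subset (hg.preimage_isClosed_of_isClosed isClosed_Icc isClosed_Ici)
      Set.inter_subset_left
  obtain ⟨t₀, ⟨ht₀, hgt₀⟩, hmin⟩ := hK.exists_isLeast ⟨t, ht, hgt.le⟩
  obtain ⟨t₁, ht₁, hgt₁⟩ := intermediate_value_Icc ht₀.1
    (hg.mono (Set.Icc_subset_Icc_right ht₀.2)) ⟨h0.le, hgt₀⟩
  have he : t₁ = t₀ := le_antisymm ht₁.2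
    (hmin ⟨⟨ht₁.1, ht₁.2.trans ht₀.2⟩, hgt₁.ge⟩)
  subst he
  refine (h t₁ ht₀ fun τ hτ => ?_).ne hgt₁
  by_contra! hlt
  have := hmin ⟨⟨hτ.1, hτ.2.trans ht₀.2⟩, hlt.le⟩
  have : τ = t₁ := le_antisymm hτ.2 this
  rw [this, hgt₁] at hlt
  exact lt_irrefl _ hlt

/-! ### The vector field -/

namespace NormalForm

variable {α s₀ r : ℝ} (S : NormalForm α s₀ r) (κ : Cutoffs)

lemma norm_disp_le (hα₀ : 0 ≤ α) (hα : α ≤ 1) {v : ℤ → ℂ} (hv : MemHs 2 v) (k : ℤ) :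
    ‖disp α v k‖ ≤ hsNorm 2 v * jap k := by
  unfold disp
  rw [norm_mul, norm_mul, norm_neg, Complex.norm_I, one_mul, Complex.norm_real,
    Real.norm_of_nonneg (Real.rpow_nonneg (abs_nonneg _) _)]
  have h1 : |(k : ℝ)| ^ α ≤ jap k := by
    calc _ ≤ jap k ^ α := Real.rpow_le_rpow (abs_nonneg _) (abs_le_jap _) hα₀
      _ ≤ jap k ^ (1 : ℝ) := jap_rpow_mono _ hα
      _ = _ := Real.rpow_one _
  have h2 : ‖v k‖ ≤ hsNorm 2 v := by
    refine (norm_coeff_le hv k).trans (mul_le_of_le_one_right (hsNorm_nonneg _ _) ?_)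
    exact Real.rpow_le_one_of_one_le_of_nonpos (one_le_jap _) (by norm_num)
  rw [mul_comm]
  exact mul_le_mul h2 h1 (Real.rpow_nonneg (abs_nonneg _) _) (hsNorm_nonneg _ _)

lemma pair_disp (α : ℝ) (v : ℤ → ℂ) : pair v (disp α v) = 0 := by
  unfold pair
  refine (tsum_congr fun k => ?_).trans tsum_zero
  simp [disp]
  ring

lemma norm_yLam_le {z : ℤ → ℂ} (h : ∀ k, ‖z k‖ ≤ 1) (k : ℤ) : ‖yLam z k‖ ≤ 1 * jap k := by
  have hj := one_le_jap k
  have key : ∀ k, ‖z k‖ ^ 2 * ‖z k‖ ≤ 1 := fun k =>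
    mul_le_one₀ (pow_le_one₀ (norm_nonneg _) (h k)) (norm_nonneg _) (h k)
  unfold yLam
  split_ifs <;> simp only [norm_mul, norm_neg, Complex.norm_I, norm_pow, Complex.norm_real,
    norm_norm, one_mul, norm_zero]
  · exact (key 1).trans hj
  · exact (key (-1)).trans hj
  · linarith

/-- The field only rotates the phases of `z_1` and `z_{-1}`. -/
lemma pair_yLam (z : ℤ → ℂ) : pair z (yLam z) = 0 := by
  unfold pair
  refine (tsum_congr fun k => ?_).trans tsum_zero
  unfold yLam
  split_ifs with h1 h2
  · subst h1
    have : conj (z 1) * (-Complex.I * (‖z 1‖ : ℂ) ^ 2 * z 1) =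
        -Complex.I * ((‖z 1‖ ^ 2 * Complex.normSq (z 1) : ℝ) : ℂ) := by
      push_cast; rw [Complex.normSq_eq_conj_mul_self]; ring
    rw [this, Complex.re_mul_ofReal]; simp
  · subst h2
    have : conj (z (-1)) * (Complex.I * (‖z (-1)‖ : ℂ) ^ 2 * z (-1)) =
        Complex.I * ((‖z (-1)‖ ^ 2 * Complex.normSq (z (-1)) : ℝ) : ℂ) := by
      push_cast; rw [Complex.normSq_eq_conj_mul_self]; ring
    rw [this, Complex.re_mul_ofReal]; simp
  · simp

/-- The projection is self-adjoint, so it can be removed before skewness is applied to `Π^⊤ Op(im₄)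
z^⊤`. -/
lemma pair_top_top (z F : ℤ → ℂ) : pair (top z) (top F) = pair (top z) F := by
  unfold pair
  refine tsum_congr fun k => ?_
  unfold top
  split_ifs <;> simp

/-- The part of the vector field that contributes to the `L²` norm of the normal component. -/
lemma exists_rhsPerp_bound (hα₀ : 0 ≤ α) (hα : α ≤ 1) : ∃ A r₁ : ℝ, 0 ≤ A ∧ 0 < r₁ ∧
    ∀ z, MemHs s₀ z → MemHs 2 z → hsNorm s₀ z < r₁ →
      (∀ k : ℤ, ‖S.rhsPerp κ z k‖ ≤ A * (1 + hsNorm 2 z) * jap k) ∧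
      pair (perp z) (S.rhsPerp κ z) ≤
        A * (hsNorm s₀ (perp z) ^ 2 * hsNorm s₀ z + hsNorm s₀ z ^ 5) * hsNorm 0 (perp z) := by
  obtain ⟨X, hX, hχ, hχ₂⟩ := κ.exists_bound
  obtain ⟨A₂, hA₂, him₂⟩ := S.exists_im₂_bound hα
  obtain ⟨A₄, r₄, hA₄, hr₄, him₄⟩ := S.exists_im₄_bound hα
  obtain ⟨AB, rB, hAB, hrB, hB⟩ := S.exists_bZ_bound
  obtain ⟨AR, hAR, hRb⟩ :=
    exists_cubic_bound S.μR_nonneg S.μR_le S.R_smoothing S.R_one S.R_two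
  have hK := embConst_nonneg
  -- The first constant controls the growth of the coefficients, the second the pairing. In the
  -- radius, `r` ensures that the symbols are real and `1` absorbs surplus powers of the norm.
  refine ⟨max (1 + X * A₂ * embConst * (2 * embConst) ^ 2 + X * A₄ * embConst + 2 * (AR + AB))
    ((AR + AB) * embConst), min (min r₄ rB) (min r 1), le_max_of_le_left (by positivity), ?_, ?_⟩
  · have hr : 0 < r := by
      obtain ⟨r', h1, h2, -⟩ := S.V₄_symbol.bound s₀ le_rfl
      exact h1.trans h2
    exact lt_min (lt_min hr₄ hrB) (lt_min hr one_pos)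
  intro z hz hz2 hzr
  obtain ⟨⟨hz4, hzB⟩, hzr', hz1⟩ : (hsNorm s₀ z < r₄ ∧ hsNorm s₀ z < rB) ∧
      hsNorm s₀ z < r ∧ hsNorm s₀ z < 1 := by simpa only [lt_min_iff] using hzr
  set v := perp z with hv
  have hv2 : MemHs 2 v := hz2.mono_of_norm_le (norm_perp_le z)
  have hv0 : MemHs 0 v := hv2.mono (by norm_num)
  have hvn : hsNorm 2 v ≤ hsNorm 2 z := hsNorm_le_of_norm_le hz2 (norm_perp_le z)
  have hps : hsNorm s₀ v ≤ hsNorm s₀ z := hsNorm_le_of_norm_le hz (norm_perp_le z)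
  have h0 := hsNorm_nonneg s₀ z
  have hp0 := hsNorm_nonneg s₀ v
  have hn0 := hsNorm_nonneg 2 z
  have htv : ∑' j : ℤ, jap j * ‖v j‖ ≤ embConst * hsNorm 2 z := by
    have := (summable_and_tsum_jap_mul_norm_le (μ := 1) (by norm_num) hv2).2
    simp only [Real.rpow_one] at this
    exact this.trans (by gcongr)
  have htv0 : 0 ≤ ∑' j : ℤ, jap j * ‖v j‖ :=
    tsum_nonneg fun k => mul_nonneg (jap_pos _).le (norm_nonneg _)
  have hw := (wAmp_sum S.μa_le hz).2
  have hw0 : 0 ≤ ∑' i, wAmp S.μa z i := tsum_nonneg (wAmp_nonneg _ _)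
  have hw' : ∑' i, wAmp S.μa z i ≤ 2 * embConst :=
    hw.trans (mul_le_of_le_one_right (by positivity) hz1.le)
  have b1 : ∀ k : ℤ, ‖disp α v k‖ ≤ hsNorm 2 z * jap k := fun k =>
    (norm_disp_le hα₀ hα hv2 k).trans (by have := (jap_pos k).le; gcongr)
  have b2 : ∀ k : ℤ, ‖opHom κ S.im₂ z v k‖ ≤
      X * A₂ * embConst * (2 * embConst) ^ 2 * hsNorm 2 z * jap k := fun k => by
    refine (opHom_bound hX hA₂ hχ₂ him₂ S.μa_le hz hv2 k).trans ?_
    have := (jap_pos k).le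
    calc _ ≤ X * A₂ * (embConst * hsNorm 2 z) * ((2 * embConst) * (2 * embConst)) * jap k := by
          gcongr
      _ = _ := by ring
  have b3 : ∀ k : ℤ, ‖opNonhom κ (S.im₄ z) v k‖ ≤
      X * A₄ * embConst * hsNorm 2 z * jap k := fun k => by
    refine (opNonhom_bound hX hχ (him₄ z hz hz4) hv2 k).trans ?_
    have := (jap_pos k).le
    calc _ ≤ X * A₄ * (embConst * hsNorm 2 z) * jap k := by gcongr
      _ = _ := by ring
  have b4 : ∀ k : ℤ, ‖(S.y3Perp z + S.y5Perp z) k‖ ≤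
      ((AR + AB) * (hsNorm s₀ v ^ 2 * hsNorm s₀ z + hsNorm s₀ z ^ 5)) * jap k ^ (-1 : ℝ) :=
    fun k => by
      have hj := (jap_rpow_pos k (-1)).le
      by_cases hk : k = 1 ∨ k = -1
      · have : (S.y3Perp z + S.y5Perp z) k = 0 := by
          simp [NormalForm.y3Perp, NormalForm.y5Perp, perp, hk]
        rw [this, norm_zero]
        positivity
      -- `Π₀X` lives on `Λ`, so subtracting it does not alter the normal equation.
      · have hc0 : cubicProj 0 S.R z k = 0 := by
          rw [S.R_zero z hz]
          simp only [not_or] at hk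
          simp [yLam, hk]
        have e : (S.y3Perp z + S.y5Perp z) k =
            (cubic S.R z k - cubicProj 0 S.R z k) + S.bZ z k := by
          simp [NormalForm.y3Perp, NormalForm.y5Perp, perp, hk, hc0]
        rw [e]
        refine (norm_add_le _ _).trans ((add_le_add (hRb z hz k) (hB z hz hzB k)).trans ?_)
        rw [← add_mul]
        gcongr
        have : 0 ≤ AR * hsNorm s₀ z ^ 5 := by positivity
        have : 0 ≤ AB * (hsNorm s₀ v ^ 2 * hsNorm s₀ z) := by positivity
        linarith
  have b4' : ∀ k : ℤ, ‖(S.y3Perp z + S.y5Perp z) k‖ ≤ (2 * (AR + AB)) * jap k := fun k => by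
    refine (b4 k).trans ?_
    have hj : jap k ^ (-1 : ℝ) ≤ jap k := by
      simpa using jap_rpow_mono k (by norm_num : (-1 : ℝ) ≤ 1)
    have hj0 := (jap_rpow_pos k (-1)).le
    have h5 : hsNorm s₀ z ^ 5 ≤ 1 := pow_le_one₀ h0 hz1.le
    have h2 : hsNorm s₀ v ^ 2 * hsNorm s₀ z ≤ 1 :=
      mul_le_one₀ (pow_le_one₀ hp0 (hps.trans hz1.le)) h0 hz1.le
    calc _ ≤ ((AR + AB) * (1 + 1)) * jap k := by gcongr
      _ = _ := by ring
  have e : S.rhsPerp κ z = disp α v + opHom κ S.im₂ z v + opNonhom κ (S.im₄ z) v +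
      (S.y3Perp z + S.y5Perp z) := by
    unfold NormalForm.rhsPerp NormalForm.opM
    rw [← hv]
    abel
  have b12 : ∀ k : ℤ, ‖(disp α v + opHom κ S.im₂ z v) k‖ ≤
      (hsNorm 2 z + X * A₂ * embConst * (2 * embConst) ^ 2 * hsNorm 2 z) * jap k := fun k => by
    rw [add_mul]; exact (norm_add_le _ _).trans (add_le_add (b1 k) (b2 k))
  have b123 : ∀ k : ℤ, ‖(disp α v + opHom κ S.im₂ z v + opNonhom κ (S.im₄ z) v) k‖ ≤
      (hsNorm 2 z + X * A₂ * embConst * (2 * embConst) ^ 2 * hsNorm 2 z +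
        X * A₄ * embConst * hsNorm 2 z) * jap k := fun k => by
    rw [add_mul]; exact (norm_add_le _ _).trans (add_le_add (b12 k) (b3 k))
  constructor
  · intro k
    rw [e]
    refine (norm_add_le _ _).trans ((add_le_add (b123 k) (b4' k)).trans ?_)
    rw [← add_mul]
    refine mul_le_mul_of_nonneg_right ?_ (jap_pos k).le
    refine le_trans ?_ (mul_le_mul_of_nonneg_right (le_max_left _ _) (by positivity))
    have : 0 ≤ 1 + X * A₂ * embConst * (2 * embConst) ^ 2 + X * A₄ * embConst := by positivity
    have : 0 ≤ 2 * (AR + AB) * hsNorm 2 z := by positivity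
    linarith
  · rw [e, pair_add hv2 b123 b4', pair_add hv2 b12 b3, pair_add hv2 b1 b2, pair_disp]
    have s2 : pair v (opHom κ S.im₂ z v) = 0 :=
      opHom_skew hA₂ him₂ S.conj_im₂ S.μa_le hz hv2
    have s4 : pair v (opNonhom κ (S.im₄ z) v) = 0 :=
      opNonhom_skew (him₄ z hz hz4) (S.conj_im₄ hz hzr') hv2
    rw [s2, s4, add_zero, add_zero, zero_add]
    refine (pair_le hv0 b4).trans ?_
    have hv00 := hsNorm_nonneg 0 v
    calc _ = ((AR + AB) * embConst) * (hsNorm s₀ v ^ 2 * hsNorm s₀ z + hsNorm s₀ z ^ 5) *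
          hsNorm 0 v := by ring
      _ ≤ _ := by gcongr; exact le_max_right _ _

end NormalForm

namespace NormalForm

variable {α s₀ r : ℝ} (S : NormalForm α s₀ r) (κ : Cutoffs)

/-- The part of the vector field that contributes to the `L²` norm of the tangential component. -/
lemma exists_rhsTop_bound (hα₀ : 0 ≤ α) (hα : α ≤ 1) : ∃ A r₁ : ℝ, 0 ≤ A ∧ 0 < r₁ ∧
    ∀ z, MemHs s₀ z → MemHs 2 z → hsNorm s₀ z < r₁ →
      (∀ k : ℤ, ‖top (S.rhsTop κ z) k‖ ≤ A * (1 + hsNorm 2 z) * jap k) ∧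
      pair (top z) (top (S.rhsTop κ z)) ≤
        A * (hsNorm s₀ (perp z) ^ 2 * hsNorm s₀ z + hsNorm s₀ z ^ 5) * hsNorm 0 (top z) := by
  obtain ⟨X, hX, hχ, hχ₂⟩ := κ.exists_bound
  obtain ⟨A₄, r₄, hA₄, hr₄, him₄⟩ := S.exists_im₄_bound hα
  obtain ⟨AB, rB, hAB, hrB, hB⟩ := S.exists_bZ_bound
  obtain ⟨AR, hAR, hRb⟩ :=
    exists_cubic_bound S.μR_nonneg S.μR_le S.R_smoothing S.R_one S.R_two
  have hK := embConst_nonneg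
  refine ⟨max (2 + X * A₄ * embConst + 2 * (AR + AB))
    ((AR + AB) * embConst), min (min r₄ rB) (min r 1), le_max_of_le_left (by positivity), ?_, ?_⟩
  · have hr : 0 < r := by
      obtain ⟨r', h1, h2, -⟩ := S.V₄_symbol.bound s₀ le_rfl
      exact h1.trans h2
    exact lt_min (lt_min hr₄ hrB) (lt_min hr one_pos)
  intro z hz hz2 hzr
  obtain ⟨⟨hz4, hzB⟩, hzr', hz1⟩ : (hsNorm s₀ z < r₄ ∧ hsNorm s₀ z < rB) ∧
      hsNorm s₀ z < r ∧ hsNorm s₀ z < 1 := by simpa only [lt_min_iff] using hzr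
  set v := top z with hv
  have hv2 : MemHs 2 v := hz2.mono_of_norm_le (norm_top_le z)
  have hv0 : MemHs 0 v := hv2.mono (by norm_num)
  have hvn : hsNorm 2 v ≤ hsNorm 2 z := hsNorm_le_of_norm_le hz2 (norm_top_le z)
  have hps : hsNorm s₀ (perp z) ≤ hsNorm s₀ z := hsNorm_le_of_norm_le hz (norm_perp_le z)
  have h0 := hsNorm_nonneg s₀ z
  have hp0 := hsNorm_nonneg s₀ (perp z)
  have hn0 := hsNorm_nonneg 2 z
  have htv : ∑' j : ℤ, jap j * ‖v j‖ ≤ embConst * hsNorm 2 z := by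
    have := (summable_and_tsum_jap_mul_norm_le (μ := 1) (by norm_num) hv2).2
    simp only [Real.rpow_one] at this
    exact this.trans (by gcongr)
  have hv1 : ∀ k, ‖v k‖ ≤ 1 := fun k => by
    refine (norm_top_le z k).trans ((norm_coeff_le hz k).trans
      (mul_le_one₀ hz1.le (jap_rpow_pos _ _).le
        (Real.rpow_le_one_of_one_le_of_nonpos (one_le_jap _) ?_)))
    linarith [S.one_le_s₀]
  have b1 : ∀ k : ℤ, ‖disp α v k‖ ≤ hsNorm 2 z * jap k := fun k =>
    (norm_disp_le hα₀ hα hv2 k).trans (by have := (jap_pos k).le; gcongr)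
  have b2 : ∀ k : ℤ, ‖yLam v k‖ ≤ 1 * jap k := norm_yLam_le hv1
  have b3 : ∀ k : ℤ, ‖opNonhom κ (S.im₄ z) v k‖ ≤
      X * A₄ * embConst * hsNorm 2 z * jap k := fun k => by
    refine (opNonhom_bound hX hχ (him₄ z hz hz4) hv2 k).trans ?_
    have := (jap_pos k).le
    calc _ ≤ X * A₄ * (embConst * hsNorm 2 z) * jap k := by gcongr
      _ = _ := by ring
  set G : ℤ → ℂ := (cubic S.R z - cubicProj 0 S.R z) + S.bZ z with hG
  have b4 : ∀ k : ℤ, ‖G k‖ ≤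
      ((AR + AB) * (hsNorm s₀ (perp z) ^ 2 * hsNorm s₀ z + hsNorm s₀ z ^ 5)) *
        jap k ^ (-1 : ℝ) := fun k => by
    have hj := (jap_rpow_pos k (-1)).le
    refine (norm_add_le _ _).trans ((add_le_add (hRb z hz k) (hB z hz hzB k)).trans ?_)
    rw [← add_mul]
    gcongr
    have : 0 ≤ AR * hsNorm s₀ z ^ 5 := by positivity
    have : 0 ≤ AB * (hsNorm s₀ (perp z) ^ 2 * hsNorm s₀ z) := by positivity
    linarith
  have b4' : ∀ k : ℤ, ‖G k‖ ≤ (2 * (AR + AB)) * jap k := fun k => by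
    refine (b4 k).trans ?_
    have hj : jap k ^ (-1 : ℝ) ≤ jap k := by
      simpa using jap_rpow_mono k (by norm_num : (-1 : ℝ) ≤ 1)
    have hj0 := (jap_rpow_pos k (-1)).le
    have h5 : hsNorm s₀ z ^ 5 ≤ 1 := pow_le_one₀ h0 hz1.le
    have h2 : hsNorm s₀ (perp z) ^ 2 * hsNorm s₀ z ≤ 1 :=
      mul_le_one₀ (pow_le_one₀ hp0 (hps.trans hz1.le)) h0 hz1.le
    calc _ ≤ ((AR + AB) * (1 + 1)) * jap k := by gcongr
      _ = _ := by ring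
  have e : top (S.rhsTop κ z) = top (disp α v + yLam v + opNonhom κ (S.im₄ z) v + G) := by
    unfold NormalForm.rhsTop NormalForm.y3Top NormalForm.y5Top
    rw [← hv, hG]
    funext k
    by_cases hk : k = 1 ∨ k = -1
    · simp only [top, hk, if_true, Pi.add_apply, Pi.sub_apply]
      ring
    · simp only [top, hk, if_false]
  have b12 : ∀ k : ℤ, ‖(disp α v + yLam v) k‖ ≤ (hsNorm 2 z + 1) * jap k := fun k => by
    rw [add_mul]; exact (norm_add_le _ _).trans (add_le_add (b1 k) (b2 k))
  have b123 : ∀ k : ℤ, ‖(disp α v + yLam v + opNonhom κ (S.im₄ z) v) k‖ ≤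
      (hsNorm 2 z + 1 + X * A₄ * embConst * hsNorm 2 z) * jap k := fun k => by
    rw [add_mul]; exact (norm_add_le _ _).trans (add_le_add (b12 k) (b3 k))
  rw [e]
  constructor
  · intro k
    refine (norm_top_le _ k).trans
      ((norm_add_le _ _).trans ((add_le_add (b123 k) (b4' k)).trans ?_))
    rw [← add_mul]
    refine mul_le_mul_of_nonneg_right ?_ (jap_pos k).le
    refine le_trans ?_ (mul_le_mul_of_nonneg_right (le_max_left _ _) (by positivity))
    have : 0 ≤ X * A₄ * embConst := by positivity
    have : 0 ≤ 2 * (AR + AB) * hsNorm 2 z := by positivity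
    linarith
  · rw [pair_top_top, ← hv, pair_add hv2 b123 b4', pair_add hv2 b12 b3, pair_add hv2 b1 b2,
      pair_disp, pair_yLam]
    have s4 : pair v (opNonhom κ (S.im₄ z) v) = 0 :=
      opNonhom_skew (him₄ z hz hz4) (S.conj_im₄ hz hzr') hv2
    rw [s4, add_zero, add_zero, zero_add]
    refine (pair_le hv0 b4).trans ?_
    have hv00 := hsNorm_nonneg 0 v
    calc _ = ((AR + AB) * embConst) *
          (hsNorm s₀ (perp z) ^ 2 * hsNorm s₀ z + hsNorm s₀ z ^ 5) * hsNorm 0 v := by ring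
      _ ≤ _ := by gcongr; exact le_max_right _ _

end NormalForm

/-! ### Interpolation and smallness -/

/-- With `l = s₀/s`, both terms of the split acquire the exponent `6 - 3θ - l(6 - θ)`. The bound on
`θ` reads `θ(2 - l) < 1 - 3l` and makes this at least `4 + 2θ/3`; the surplus `ε^(2θ/3)` absorbs the
factor `2` from adding the terms. -/
lemma hsNorm_le_sq_of_interpolation {s₀ s θ ε : ℝ} (hs₀ : 0 ≤ s₀) (hs : 3 * s₀ < s)
    (hθ : 0 < θ) (hθs : θ < (s - 3 * s₀) / (2 * s - s₀)) (hε : 0 < ε) (hε1 : ε < 1)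
    (hεθ : 2 * ε ^ (2 / 3 * θ) ≤ 1) {w : ℤ → ℂ} (hw : MemHs s w)
    (h0 : hsNorm 0 w ≤ ε ^ (3 - 3 / 2 * θ)) (h1 : hsNorm s w ≤ ε ^ (-θ)) :
    hsNorm s₀ w ≤ ε ^ 2 := by
  have hspos : 0 < s := by linarith
  obtain ⟨l, hl⟩ : ∃ l, l = s₀ / s := ⟨_, rfl⟩
  have hls : s₀ = l * s := by rw [hl]; field_simp
  have hl0 : 0 ≤ l := by rw [hl]; positivity
  have hl3 : 3 * l < 1 := by
    by_contra! h
    nlinarith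
  have hθl : θ * (2 - l) < 1 - 3 * l := by
    rw [lt_div_iff₀ (by linarith), hls] at hθs
    by_contra! h
    nlinarith
  -- This `N` balances the two terms: `N^(2s) = ε^(-2θ) / ε^(6 - 3θ)`.
  have hN : 0 < ε ^ (-(3 - θ / 2) / s) := Real.rpow_pos_of_pos hε _
  have key := hsNorm_sq_le_split hs₀ (by linarith) hN hw
  have sq_rpow : ∀ x : ℝ, (ε ^ x) ^ 2 = ε ^ (2 * x) := fun x => by
    rw [← Real.rpow_natCast (ε ^ x), ← Real.rpow_mul hε.le, mul_comm]; norm_num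
  have hpow : ∀ x y : ℝ, 4 + 2 / 3 * θ ≤ x + y → ε ^ x * ε ^ y ≤ ε ^ (2 / 3 * θ) * ε ^ 4 :=
    fun x y hxy => by
      rw [← Real.rpow_add hε, ← Real.rpow_natCast, ← Real.rpow_add hε]
      refine Real.rpow_le_rpow_of_exponent_ge hε hε1.le ?_
      push_cast
      linarith
  have a0 : hsNorm 0 w ^ 2 ≤ ε ^ (2 * (3 - 3 / 2 * θ)) := by
    rw [← sq_rpow]; exact pow_le_pow_left₀ (hsNorm_nonneg _ _) h0 2
  have a1 : hsNorm s w ^ 2 ≤ ε ^ (2 * -θ) := by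
    rw [← sq_rpow]; exact pow_le_pow_left₀ (hsNorm_nonneg _ _) h1 2
  rw [← Real.rpow_mul hε.le, ← Real.rpow_mul hε.le] at key
  have e1 : -(3 - θ / 2) / s * (2 * s₀) = -(3 - θ / 2) * (2 * l) := by rw [hl]; ring
  have e2 : -(3 - θ / 2) / s * (2 * s₀ - 2 * s) = -(3 - θ / 2) * (2 * l - 2) := by
    rw [hls]; field_simp
  rw [e1, e2] at key
  have c0 := (mul_le_mul_of_nonneg_left a0
    (Real.rpow_pos_of_pos hε (-(3 - θ / 2) * (2 * l))).le).trans (hpow _ _ (by nlinarith))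
  have c1 := (mul_le_mul_of_nonneg_left a1
    (Real.rpow_pos_of_pos hε (-(3 - θ / 2) * (2 * l - 2))).le).trans (hpow _ _ (by nlinarith))
  refine (pow_le_pow_iff_left₀ (hsNorm_nonneg _ _) (by positivity) two_ne_zero).1 ?_
  have h4 : 0 < ε ^ 4 := by positivity
  nlinarith

/-- In order, the last four conditions keep `z` in the ball of the estimates, close the
interpolation, and improve the normal and then the tangential energy. -/
lemma exists_small {θ : ℝ} (hθ : 0 < θ) (C C' r₁ : ℝ) (hr₁ : 0 < r₁) : ∃ ε₀ : ℝ, 0 < ε₀ ∧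
    ∀ ε : ℝ, 0 < ε → ε < ε₀ → ε < 1 ∧ 3 * ε < r₁ ∧ 2 * ε ^ (2 / 3 * θ) ≤ 1 ∧
      ε ^ (3 * θ) + C * ε ^ (θ / 2) < 1 ∧ C' * ε < 3 := by
  have hc : ∀ c : ℝ, 0 < c → Tendsto (fun ε : ℝ => ε ^ c) (𝓝[>] 0) (𝓝 0) := fun c hc => by
    have := (Real.continuousAt_rpow_const 0 c (Or.inr hc.le)).tendsto
    rw [Real.zero_rpow hc.ne'] at this
    exact this.mono_left nhdsWithin_le_nhds
  have hid : Tendsto (fun ε : ℝ => ε) (𝓝[>] 0) (𝓝 0) := tendsto_id.mono_left nhdsWithin_le_nhds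
  have e1 : ∀ᶠ ε : ℝ in 𝓝[>] 0, ε < 1 := hid.eventually_lt_const one_pos
  have e2 : ∀ᶠ ε : ℝ in 𝓝[>] 0, 3 * ε < r₁ :=
    (hid.const_mul 3).eventually_lt_const (by simpa using hr₁)
  have e3 : ∀ᶠ ε : ℝ in 𝓝[>] 0, 2 * ε ^ (2 / 3 * θ) < 1 :=
    ((hc _ (by positivity)).const_mul 2).eventually_lt_const (by norm_num)
  have e4 : ∀ᶠ ε : ℝ in 𝓝[>] 0, ε ^ (3 * θ) + C * ε ^ (θ / 2) < 1 :=
    ((hc _ (by positivity)).add ((hc _ (by positivity)).const_mul C)).eventually_lt_const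
      (by norm_num)
  have e5 : ∀ᶠ ε : ℝ in 𝓝[>] 0, C' * ε < 3 :=
    (hid.const_mul C').eventually_lt_const (by norm_num)
  have := e1.and (e2.and (e3.and (e4.and e5)))
  obtain ⟨ε₀, hε₀, h⟩ := mem_nhdsGT_iff_exists_Ioo_subset.1 this
  refine ⟨ε₀, hε₀, fun ε h1 h2 => ?_⟩
  obtain ⟨a, b, c, d, e⟩ := h ⟨h1, h2⟩
  exact ⟨a, b, c.le, d, e⟩

lemma norm_le_of_hsNorm_le {s M : ℝ} (hs : 3 ≤ s) {u v : ℤ → ℂ} (hu : MemHs s u)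
    (hM : hsNorm s u ≤ M) (hv : ∀ k, ‖v k‖ ≤ ‖u k‖) (k : ℤ) :
    ‖v k‖ ≤ M * jap k ^ (-3 : ℝ) := by
  have h1 : jap k ^ (-s) ≤ jap k ^ (-3 : ℝ) := jap_rpow_mono _ (by linarith)
  have h2 := (jap_rpow_pos k (-s)).le
  have h3 := (hsNorm_nonneg s u).trans hM
  calc _ ≤ _ := hv k
    _ ≤ _ := norm_coeff_le hu k
    _ ≤ _ := by gcongr

/-- The bounds on the solution at one time, and those on its energy, under the bootstrap
hypothesis. -/
lemma hsNorm_le_of_bootstrap {s₀ s θ ε : ℝ} (hs₀ : 0 ≤ s₀) (hs : 3 * s₀ < s)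
    (hθ : 0 < θ) (hθs : θ < (s - 3 * s₀) / (2 * s - s₀)) (hε : 0 < ε) (hε1 : ε < 1)
    (hεθ : 2 * ε ^ (2 / 3 * θ) ≤ 1) {u : ℤ → ℂ} (hu : MemHs s u) (hM : hsNorm s u ≤ ε ^ (-θ))
    (htop : ∑' k, ‖top u k‖ ^ 2 ≤ 4 * ε ^ 2)
    (hperp : ∑' k, ‖perp u k‖ ^ 2 ≤ (ε ^ (3 - 3 / 2 * θ)) ^ 2) :
    (hsNorm 0 (top u) ≤ 2 * ε ∧ hsNorm 0 (perp u) ≤ ε ^ (3 - 3 / 2 * θ)) ∧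
      (hsNorm s₀ u ≤ 3 * ε ∧ hsNorm s₀ (perp u) ≤ ε ^ 2) := by
  rw [← hsNorm_zero_sq] at htop hperp
  have h1 : hsNorm 0 (top u) ≤ 2 * ε :=
    (pow_le_pow_iff_left₀ (hsNorm_nonneg _ _) (by positivity) two_ne_zero).1
      (htop.trans (le_of_eq (by ring)))
  have h2 : hsNorm 0 (perp u) ≤ ε ^ (3 - 3 / 2 * θ) :=
    (pow_le_pow_iff_left₀ (hsNorm_nonneg _ _) (by positivity) two_ne_zero).1 hperp
  have h3 : hsNorm s₀ (perp u) ≤ ε ^ 2 :=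
    hsNorm_le_sq_of_interpolation hs₀ hs hθ hθs hε hε1 hεθ (hu.mono_of_norm_le (norm_perp_le u)) h2
      ((hsNorm_le_of_norm_le hu (norm_perp_le u)).trans hM)
  refine ⟨⟨h1, h2⟩, ?_, h3⟩
  refine (pow_le_pow_iff_left₀ (hsNorm_nonneg _ _) (by positivity) two_ne_zero).1 ?_
  rw [hsNorm_sq_eq_top_add_perp (hu.mono (by linarith : s₀ ≤ s)), hsNorm_top]
  have h4 : hsNorm s₀ (perp u) ≤ ε := h3.trans (by nlinarith)
  have h5 := hsNorm_nonneg s₀ (perp u)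
  nlinarith

end QNLS

end

/-! ### Closing the bootstrap -/

theorem lemma5p3 {α s₀ r : ℝ} (hα₀ : 0 < α) (hα₁ : α < 1) (hr : 0 < r)
    (S : QNLS.NormalForm α s₀ r) (κ : QNLS.Cutoffs)
    (θ T₀ : ℝ) (hθ : 0 < θ) (hT₀ : 0 < T₀) :
    ∃ εstar : ℝ, 0 < εstar ∧
      ∀ s : ℝ, 3 * s₀ < s → θ < min ((s - 3 * s₀) / (2 * s - s₀)) (1 / 5) →
      ∀ ε : ℝ, 0 < ε → ε < εstar →
      ∀ (T : ℝ) (z : ℝ → ℤ → ℂ), S.LongTimeControlled κ s θ T ε z →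
        T ≤ T₀ / ε ^ 2 * Real.log (1 / ε) →
        ∀ t ∈ Set.Icc 0 T,
          (QNLS.hsNorm 0 (QNLS.top (z t)) ≤ 2 * ε ∧
            QNLS.hsNorm 0 (QNLS.perp (z t)) ≤ ε ^ (3 - 3 / 2 * θ)) ∧
          (QNLS.hsNorm s₀ (z t) ≤ 3 * ε ∧
            QNLS.hsNorm s₀ (QNLS.perp (z t)) ≤ ε ^ 2) := by
  obtain ⟨A₁, r₁, hA₁, hr₁, hTop⟩ := S.exists_rhsTop_bound κ hα₀.le hα₁.le
  obtain ⟨A₂, r₂, hA₂, hr₂, hPerp⟩ := S.exists_rhsPerp_bound κ hα₀.le hα₁.le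
  -- Under the bootstrap bounds the forcing is at most `(3 + 3⁵) ε⁵ = 246 ε⁵`. Differentiating the
  -- square doubles this to `492`; the bound `2ε` on `‖z^⊤‖` gives `984`.
  obtain ⟨ε₀, hε₀, hsmall⟩ := QNLS.exists_small hθ (492 * A₂ * T₀ / θ) (984 * A₁ * T₀)
    (min r₁ r₂) (lt_min hr₁ hr₂)
  refine ⟨ε₀, hε₀, fun s hs hθs ε hε hεlt T z hz hT => ?_⟩
  obtain ⟨hε1, hεr, hεθ, hεC, hεC'⟩ := hsmall ε hε hεlt
  have hs₀ := S.one_le_s₀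
  -- As `s₀ ≥ 1`, this provides the decay `⟨k⟩⁻³` needed to differentiate the energies.
  have hs3 : 3 ≤ s := by linarith
  have hθs' := hθs.trans_le (min_le_left _ _)
  have hmem := hz.sol.mem
  have hhigh := hz.high
  have hctop := QNLS.continuousOn_tsum_norm_sq (w := fun τ => QNLS.top (z τ))
    (fun k τ hτ => (hz.sol.eq_top τ hτ k).continuousWithinAt)
    (fun τ hτ k => QNLS.norm_le_of_hsNorm_le hs3 (hmem τ hτ) (hhigh τ hτ)
      (QNLS.norm_top_le _) k)
  have hcperp := QNLS.continuousOn_tsum_norm_sq (w := fun τ => QNLS.perp (z τ))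
    (fun k τ hτ => (hz.sol.eq_perp τ hτ k).continuousWithinAt)
    (fun τ hτ k => QNLS.norm_le_of_hsNorm_le hs3 (hmem τ hτ) (hhigh τ hτ)
      (QNLS.norm_perp_le _) k)
  set f₁ : ℝ → ℝ := fun τ => ∑' k, ‖QNLS.top (z τ) k‖ ^ 2 with hf₁
  set f₂ : ℝ → ℝ := fun τ => ∑' k, ‖QNLS.perp (z τ) k‖ ^ 2 with hf₂
  set b : ℝ := ε ^ (3 - 3 / 2 * θ) with hb
  have hbpos : 0 < b := Real.rpow_pos_of_pos hε _
  have hinit₁ : f₁ 0 ≤ ε ^ 2 := by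
    rw [hf₁]; dsimp only
    rw [← QNLS.hsNorm_zero_sq]
    exact pow_le_pow_left₀ (QNLS.hsNorm_nonneg _ _) hz.init_top 2
  have hinit₂ : f₂ 0 ≤ ε ^ 6 := by
    rw [hf₂]; dsimp only
    rw [← QNLS.hsNorm_zero_sq]
    exact (pow_le_pow_left₀ (QNLS.hsNorm_nonneg _ _) hz.init_perp 2).trans (le_of_eq (by ring))
  have hlog0 : 0 ≤ Real.log (1 / ε) := Real.log_nonneg (by rw [le_div_iff₀ hε]; linarith)
  have hlog1 : ε * Real.log (1 / ε) ≤ 1 := by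
    have := Real.log_le_sub_one_of_pos (one_div_pos.2 hε)
    calc ε * Real.log (1 / ε) ≤ ε * (1 / ε) := by gcongr; linarith
      _ = 1 := by field_simp
  have hlogθ : ε ^ θ * Real.log (1 / ε) ≤ 1 / θ := by
    have := Real.log_le_rpow_div (one_div_pos.2 hε).le hθ
    calc _ ≤ ε ^ θ * ((1 / ε) ^ θ / θ) := by gcongr
      _ = (ε * (1 / ε)) ^ θ / θ := by
          rw [Real.mul_rpow hε.le (one_div_pos.2 hε).le]; ring
      _ = 1 / θ := by rw [mul_one_div_cancel hε.ne', Real.one_rpow]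
  have hTε : ∀ t ∈ Set.Icc 0 T, ε ^ 2 * t ≤ T₀ * Real.log (1 / ε) := fun t ht => by
    calc ε ^ 2 * t ≤ ε ^ 2 * (T₀ / ε ^ 2 * Real.log (1 / ε)) := by
          gcongr; exact ht.2.trans hT
      _ = _ := by field_simp
  have hb2 : b ^ 2 * ε ^ (3 * θ) = ε ^ 6 := by
    rw [hb, ← Real.rpow_natCast (ε ^ _), ← Real.rpow_mul hε.le, ← Real.rpow_add hε,
      ← Real.rpow_natCast]
    congr 1
    push_cast
    ring
  have hbθ : b * (ε ^ (θ / 2) * ε ^ θ) = ε ^ 3 := by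
    rw [hb, ← Real.rpow_add hε, ← Real.rpow_add hε, ← Real.rpow_natCast]
    congr 1
    push_cast
    ring
  have hstep : ∀ t ∈ Set.Icc 0 T, (∀ τ ∈ Set.Icc 0 t, f₁ τ ≤ 4 * ε ^ 2 ∧ f₂ τ ≤ b ^ 2) →
      f₁ t < 4 * ε ^ 2 ∧ f₂ t < b ^ 2 := by
    intro t ht hboot
    have hsub : Set.Icc 0 t ⊆ Set.Icc 0 T := Set.Icc_subset_Icc_right ht.2
    have hbd : ∀ τ ∈ Set.Icc 0 t, _ := fun τ hτ => QNLS.hsNorm_le_of_bootstrap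
      (by linarith : 0 ≤ s₀) hs hθ hθs' hε hε1 hεθ (hmem τ (hsub hτ)) (hhigh τ (hsub hτ))
      (hboot τ hτ).1 (hboot τ hτ).2
    have hms₀ : ∀ τ ∈ Set.Icc 0 t, QNLS.MemHs s₀ (z τ) := fun τ hτ =>
      (hmem τ (hsub hτ)).mono (by linarith)
    have hm2 : ∀ τ ∈ Set.Icc 0 t, QNLS.MemHs 2 (z τ) := fun τ hτ =>
      (hmem τ (hsub hτ)).mono (by linarith)
    have hn2 : ∀ τ ∈ Set.Icc 0 t, QNLS.hsNorm 2 (z τ) ≤ ε ^ (-θ) := fun τ hτ =>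
      (QNLS.hsNorm_mono (hmem τ (hsub hτ)) (by linarith)).trans (hhigh τ (hsub hτ))
    have hforce : ∀ τ ∈ Set.Icc 0 t, QNLS.hsNorm s₀ (QNLS.perp (z τ)) ^ 2 * QNLS.hsNorm s₀ (z τ) +
        QNLS.hsNorm s₀ (z τ) ^ 5 ≤ 246 * ε ^ 5 := fun τ hτ => by
      obtain ⟨-, h1, h2⟩ := hbd τ hτ
      have n1 := QNLS.hsNorm_nonneg s₀ (z τ)
      have n2 := QNLS.hsNorm_nonneg s₀ (QNLS.perp (z τ))
      calc _ ≤ (ε ^ 2) ^ 2 * (3 * ε) + (3 * ε) ^ 5 := by gcongr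
        _ = _ := by ring
    have htε := hTε t ht
    constructor
    · have hE := QNLS.tsum_norm_sq_le_of_pair_le (w := fun τ => QNLS.top (z τ))
        (F := fun τ => QNLS.top (S.rhsTop κ (z τ))) (M := ε ^ (-θ))
        (L := A₁ * (1 + ε ^ (-θ))) (D := A₁ * (246 * ε ^ 5) * (2 * ε)) ht.1
        (fun τ hτ k => ?_)
        (fun τ hτ k => QNLS.norm_le_of_hsNorm_le hs3 (hmem τ (hsub hτ)) (hhigh τ (hsub hτ))
          (QNLS.norm_top_le _) k)
        (fun τ hτ k => ?_) (fun τ hτ => ?_)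
      · have h1 : f₁ t ≤ ε ^ 2 + 984 * A₁ * ε ^ 4 * (ε ^ 2 * t) := by
          refine hE.trans ((add_le_add_left hinit₁ _).trans (le_of_eq ?_))
          ring
        calc f₁ t ≤ _ := h1
          _ ≤ ε ^ 2 + 984 * A₁ * ε ^ 4 * (T₀ * Real.log (1 / ε)) := by gcongr
          _ = ε ^ 2 + 984 * A₁ * T₀ * ε ^ 3 * (ε * Real.log (1 / ε)) := by ring
          _ ≤ ε ^ 2 + 984 * A₁ * T₀ * ε ^ 3 * 1 := by gcongr
          _ = ε ^ 2 + (984 * A₁ * T₀ * ε) * ε ^ 2 := by ring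
          _ < ε ^ 2 + 3 * ε ^ 2 := by gcongr
          _ = _ := by ring
      · have h := (hz.sol.eq_top τ (hsub hτ) k).mono hsub
        by_cases hk : k = 1 ∨ k = -1
        · simpa [QNLS.top, hk] using h
        · simp only [QNLS.top, hk, if_false]
          exact hasDerivWithinAt_const _ _ _
      · have := (hTop (z τ) (hms₀ τ hτ) (hm2 τ hτ)
          (((hbd τ hτ).2.1.trans_lt hεr).trans_le (min_le_left _ _))).1 k
        have hj := (QNLS.jap_pos k).le
        exact this.trans (by gcongr; exact hn2 τ hτ)
      · have := (hTop (z τ) (hms₀ τ hτ) (hm2 τ hτ)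
          (((hbd τ hτ).2.1.trans_lt hεr).trans_le (min_le_left _ _))).2
        have n0 := QNLS.hsNorm_nonneg 0 (QNLS.top (z τ))
        exact this.trans (by gcongr; exacts [hforce τ hτ, (hbd τ hτ).1.1])
    · have hE := QNLS.tsum_norm_sq_le_of_pair_le (w := fun τ => QNLS.perp (z τ))
        (F := fun τ => S.rhsPerp κ (z τ)) (M := ε ^ (-θ))
        (L := A₂ * (1 + ε ^ (-θ))) (D := A₂ * (246 * ε ^ 5) * b) ht.1
        (fun τ hτ k => (hz.sol.eq_perp τ (hsub hτ) k).mono hsub)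
        (fun τ hτ k => QNLS.norm_le_of_hsNorm_le hs3 (hmem τ (hsub hτ)) (hhigh τ (hsub hτ))
          (QNLS.norm_perp_le _) k)
        (fun τ hτ k => ?_) (fun τ hτ => ?_)
      · have h1 : f₂ t ≤ ε ^ 6 + 492 * A₂ * ε ^ 3 * b * (ε ^ 2 * t) := by
          refine hE.trans ((add_le_add_left hinit₂ _).trans (le_of_eq ?_))
          ring
        calc f₂ t ≤ _ := h1
          _ ≤ ε ^ 6 + 492 * A₂ * ε ^ 3 * b * (T₀ * Real.log (1 / ε)) := by gcongr
          -- Here `ε³ = b ε^(θ/2) ε^θ`: the factor `ε^θ` pays for the logarithm and `ε^(θ/2)` gives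
          -- the strict gain.
          _ = b ^ 2 * ε ^ (3 * θ) + 492 * A₂ * T₀ * b ^ 2 * ε ^ (θ / 2) *
              (ε ^ θ * Real.log (1 / ε)) := by rw [hb2, ← hbθ]; ring
          _ ≤ b ^ 2 * ε ^ (3 * θ) + 492 * A₂ * T₀ * b ^ 2 * ε ^ (θ / 2) * (1 / θ) := by gcongr
          _ = b ^ 2 * (ε ^ (3 * θ) + 492 * A₂ * T₀ / θ * ε ^ (θ / 2)) := by ring
          _ < b ^ 2 * 1 := by gcongr
          _ = b ^ 2 := mul_one _
      · have := (hPerp (z τ) (hms₀ τ hτ) (hm2 τ hτ)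
          (((hbd τ hτ).2.1.trans_lt hεr).trans_le (min_le_right _ _))).1 k
        have hj := (QNLS.jap_pos k).le
        exact this.trans (by gcongr; exact hn2 τ hτ)
      · have := (hPerp (z τ) (hms₀ τ hτ) (hm2 τ hτ)
          (((hbd τ hτ).2.1.trans_lt hεr).trans_le (min_le_right _ _))).2
        have n0 := QNLS.hsNorm_nonneg 0 (QNLS.perp (z τ))
        exact this.trans (by gcongr; exacts [hforce τ hτ, (hbd τ hτ).1.2])
  have h60 : ε ^ 6 < b ^ 2 := by
    have hC : 0 ≤ 492 * A₂ * T₀ / θ * ε ^ (θ / 2) := by positivity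
    rw [← hb2]
    exact mul_lt_of_lt_one_right (by positivity) (by linarith)
  -- The maximum lets both energies be bootstrapped together, since each improvement uses both
  -- bounds.
  have hmain := QNLS.continuous_bootstrap (g := fun τ => max (f₁ τ - 4 * ε ^ 2) (f₂ τ - b ^ 2))
    ((hctop.sub continuousOn_const).sup (hcperp.sub continuousOn_const))
    (max_lt (by have : 0 < ε ^ 2 := by positivity
                linarith) (by linarith))
    (fun t ht h => by
      have := hstep t ht fun τ hτ => by
        have := max_le_iff.1 (h τ hτ)
        exact ⟨by linarith, by linarith⟩
      exact max_lt (by linarith) (by linarith))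
  intro t ht
  have := max_le_iff.1 (hmain t ht)
  exact QNLS.hsNorm_le_of_bootstrap (by linarith : 0 ≤ s₀) hs hθ hθs' hε hε1 hεθ
    (hmem t ht) (hhigh t ht) (by linarith) (by linarith)
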